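/- Let $G$ be a compact metrizable abelian group with Borel $\sigma$-algebra $\mathcal B(G)$, normalized Haar measure $\lambda$ and dual group $\Gamma$ (the continuous characters of $G$), and let $\Lambda\subseteq\Gamma$. For a complex Banach space $X$ let $M(G,X)$ be the space of countably additive measures $\mu:\mathcal B(G)\to X$ of bounded variation $|\mu|$, let $\hat\mu(\gamma)=\int_G\bar\gamma\,d\mu$ and, for $f\in L^1(G,X)$ (Bochner, with respect to $\lambda$), $\hat f(\gamma)=\int_G\bar\gamma f\,d\lambda$. A subscript $\Lambda$ on a space of measures or functions means that only those elements are kept whose Fourier transform vanishes off $\Lambda$: $M_\Lambda(G,X)=\{\mu\in M(G,X):\hat\mu(\gamma)=0\ \text{for all }\gamma\notin\Lambda\}$ and $L^p_\Lambda(G,X)=\{f\in L^p(G,X):\hat f(\gamma)=0\ \text{for all }\gamma\notin\Lambda\}$. Further, $M_\Lambda^\infty(G,X)=\{\mu\in M_\Lambda(G,X): |\mu|\le C\lambda\text{ for some }C>0\}$ and $M_{\Lambda,ac}(G,X)=\{\mu\in M_\Lambda(G,X):\mu\text{ is absolutely continuous with respect to }\lambda\}$. A function $f$ is identified with the measure $A\mapsto\int_A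 f\,d\lambda$. The space $X$ has the type I-$\Lambda$-RNP if $M_\Lambda^\infty(G,X)=L_\Lambda^\infty(G,X)$, and the type II-$\Lambda$-RNP if $M_{\Lambda,ac}(G,X)=L^1_\Lambda(G,X)$; $\Lambda$ is a Riesz set if $M_\Lambda(G,\mathbb C)=L^1_\Lambda(G,\mathbb C)$. Let $X$ be a complex Banach space with the Schur property (every weakly convergent sequence in $X$ converges in norm), let $\Lambda\subseteq\Gamma$ be a Riesz set, and let $L^1(\lambda)\hat\otimes_\varepsilon X$ be the injective tensor product, i.e. the completion of the algebraic tensor product $L^1(\lambda)\otimes X$ under the norm $\|u\|_\varepsilon=\sup\{|(\varphi\otimes\psi)(u)|:\varphi\in L^1(\lambda)^*,\ \psi\in X^*,\ \|\varphi\|\le1,\ \|\psi\|\le1\}$. Then $L^1(\lambda)\hat\otimes_\varepsilon X$ has the type I-$\Lambda$-RNP if and only if $X$ has the type I-$\Lambda$-RNP, and $L^1(\lambda)\hat\otimes_\varepsilon X$ has the type II-$\Lambda$-RNP if and only if $X$ has the type II-$\Lambda$-RNP. -/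

import Mathlib

open MeasureTheory Filter Topology
open scoped TensorProduct ENNReal NNReal

noncomputable section

/-! ### The injective tensor product of two complex normed spaces -/

/-- The algebraic tensor product `E ⊗ F`, to be equipped with the injective norm. -/
def InjTensor (E F : Type*) [NormedAddCommGroup E] [NormedSpace ℂ E]
    [NormedAddCommGroup F] [NormedSpace ℂ F] : Type _ := E ⊗[ℂ] F

namespace InjTensor

variable {E F : Type*} [NormedAddCommGroup E] [NormedSpace ℂ E]
  [NormedAddCommGroup F] [NormedSpace ℂ F]

instance : AddCommGroup (InjTensor E F) := inferInstanceAs (AddCommGroup (E ⊗[ℂ] F))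

instance : Module ℂ (InjTensor E F) := inferInstanceAs (Module ℂ (E ⊗[ℂ] F))

/-- The functional `φ ⊗ ψ` on `E ⊗ F`, with `(φ ⊗ ψ) (x ⊗ y) = φ x * ψ y`. -/
def pairing (φ : StrongDual ℂ E) (ψ : StrongDual ℂ F) : InjTensor E F →ₗ[ℂ] ℂ :=
  TensorProduct.lift ((LinearMap.mul ℂ ℂ).compl₁₂ φ.toLinearMap ψ.toLinearMap)

theorem pairing_tmul (φ : StrongDual ℂ E) (ψ : StrongDual ℂ F) (x : E) (y : F) :
    pairing φ ψ (x ⊗ₜ[ℂ] y : E ⊗[ℂ] F) = φ x * ψ y :=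
  TensorProduct.lift.tmul x y

/-- The injective norm
`‖u‖ = sup {|(φ ⊗ ψ) u| : φ ∈ E*, ‖φ‖ ≤ 1, ψ ∈ F*, ‖ψ‖ ≤ 1}`. -/
instance : Norm (InjTensor E F) where
  norm u := ⨆ p : {φ : StrongDual ℂ E // ‖φ‖ ≤ 1} × {ψ : StrongDual ℂ F // ‖ψ‖ ≤ 1},
    ‖pairing p.1.1 p.2.1 u‖

theorem norm_def (u : InjTensor E F) :
    ‖u‖ = ⨆ p : {φ : StrongDual ℂ E // ‖φ‖ ≤ 1} × {ψ : StrongDual ℂ F // ‖ψ‖ ≤ 1},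
      ‖pairing p.1.1 p.2.1 u‖ := rfl

theorem bddAbove_pairing (u : InjTensor E F) :
    BddAbove (Set.range fun p : {φ : StrongDual ℂ E // ‖φ‖ ≤ 1} ×
      {ψ : StrongDual ℂ F // ‖ψ‖ ≤ 1} => ‖pairing p.1.1 p.2.1 u‖) := by
  suffices h : ∃ C : ℝ, ∀ (φ : StrongDual ℂ E) (ψ : StrongDual ℂ F), ‖φ‖ ≤ 1 → ‖ψ‖ ≤ 1 →
      ‖pairing φ ψ u‖ ≤ C by
    obtain ⟨C, hC⟩ := h
    refine ⟨C, ?_⟩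
    rintro _ ⟨p, rfl⟩
    exact hC _ _ p.1.2 p.2.2
  induction u using TensorProduct.induction_on with
  | zero => exact ⟨0, fun φ ψ _ _ => (congrArg norm (map_zero (pairing φ ψ))).le.trans (by simp)⟩
  | tmul x y =>
    refine ⟨‖x‖ * ‖y‖, fun φ ψ hφ hψ => ?_⟩
    rw [pairing_tmul, norm_mul]
    gcongr
    · exact (φ.le_of_opNorm_le hφ x).trans (by simp)
    · exact (ψ.le_of_opNorm_le hψ y).trans (by simp)
  | add u v hu hv =>
    obtain ⟨C, hC⟩ := hu
    obtain ⟨D, hD⟩ := hv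
    refine ⟨C + D, fun φ ψ hφ hψ => ?_⟩
    have h : pairing φ ψ (u + v) = pairing φ ψ u + pairing φ ψ v := map_add (pairing φ ψ) u v
    exact (congrArg norm h).le.trans
      ((norm_add_le _ _).trans (add_le_add (hC φ ψ hφ hψ) (hD φ ψ hφ hψ)))

instance : Nonempty ({φ : StrongDual ℂ E // ‖φ‖ ≤ 1} × {ψ : StrongDual ℂ F // ‖ψ‖ ≤ 1}) :=
  ⟨⟨⟨0, by simp⟩, ⟨0, by simp⟩⟩⟩

theorem norm_pairing_le (u : InjTensor E F) {φ : StrongDual ℂ E} {ψ : StrongDual ℂ F}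
    (hφ : ‖φ‖ ≤ 1) (hψ : ‖ψ‖ ≤ 1) : ‖pairing φ ψ u‖ ≤ ‖u‖ :=
  le_ciSup (bddAbove_pairing u) (⟨⟨φ, hφ⟩, ⟨ψ, hψ⟩⟩ : {φ : StrongDual ℂ E // ‖φ‖ ≤ 1} ×
    {ψ : StrongDual ℂ F // ‖ψ‖ ≤ 1})

/-- The functionals `φ ⊗ ψ` separate the points of `E ⊗ F`. -/
theorem eq_zero_of_pairing (u : InjTensor E F)
    (h : ∀ (φ : StrongDual ℂ E) (ψ : StrongDual ℂ F), pairing φ ψ u = 0) : u = 0 := by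
  classical
  let b := Module.Free.chooseBasis ℂ F
  let e := TensorProduct.equivFinsuppOfBasisRight (M := E) b
  have key : ∀ (φ : StrongDual ℂ E) (ψ : StrongDual ℂ F) (v : E ⊗[ℂ] F),
      pairing φ ψ v = ψ ((e v).sum fun i x => φ x • b i) := by
    intro φ ψ v
    induction v using TensorProduct.induction_on with
    | zero => exact (map_zero (pairing φ ψ)).trans (by simp)
    | tmul x y =>
      rw [pairing_tmul, TensorProduct.equivFinsuppOfBasisRight_apply_tmul,
        Finsupp.sum_mapRange_index (by simp)]
      have hy : ((b.repr y).sum fun i c => φ (c • x) • b i) = φ x • y := by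
        conv_rhs => rw [← b.linearCombination_repr y, Finsupp.linearCombination_apply,
          Finsupp.smul_sum]
        refine Finsupp.sum_congr fun i _ => ?_
        rw [map_smul, smul_eq_mul, mul_comm, mul_smul]
      rw [hy, map_smul, smul_eq_mul]
    | add v w hv hw =>
      have hadd : pairing φ ψ (v + w) = pairing φ ψ v + pairing φ ψ w :=
        map_add (pairing φ ψ) v w
      refine hadd.trans ?_
      rw [hv, hw, map_add, Finsupp.sum_add_index' (by simp)
        (fun i x y => by rw [map_add, add_smul]), map_add]
  have hu : e u = 0 := by
    ext i
    refine SeparatingDual.eq_zero_of_forall_dual_eq_zero (R := ℂ) fun φ => ?_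
    have hs : ((e u).sum fun i x => φ x • b i) = 0 :=
      SeparatingDual.eq_zero_of_forall_dual_eq_zero (R := ℂ) fun ψ =>
        (key φ ψ u).symm.trans (h φ ψ)
    by_cases hi : i ∈ (e u).support
    · exact linearIndependent_iff'.1 b.linearIndependent _ (fun i => φ (e u i)) hs i hi
    · rw [Finsupp.notMem_support_iff.1 hi, map_zero]
  exact (LinearEquiv.map_eq_zero_iff e).1 hu

theorem core : NormedSpace.Core ℂ (InjTensor E F) where
  norm_nonneg u := Real.iSup_nonneg fun _ => norm_nonneg _
  norm_smul c u := by
    simp only [norm_def, map_smul, norm_smul]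
    exact (Real.mul_iSup_of_nonneg (norm_nonneg c) _).symm
  norm_triangle u v := by
    refine ciSup_le fun p => ?_
    rw [map_add]
    exact (norm_add_le _ _).trans
      (add_le_add (norm_pairing_le u p.1.2 p.2.2) (norm_pairing_le v p.1.2 p.2.2))
  norm_eq_zero_iff u := by
    refine ⟨fun hu => eq_zero_of_pairing u fun φ ψ => ?_, fun hu => by simp [norm_def, hu]⟩
    have hφ : ‖((‖φ‖ + 1 : ℝ) : ℂ)⁻¹ • φ‖ ≤ 1 := by
      rw [norm_smul, norm_inv, Complex.norm_real, Real.norm_of_nonneg (by positivity),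
        inv_mul_le_one₀ (by positivity)]
      linarith
    have hψ : ‖((‖ψ‖ + 1 : ℝ) : ℂ)⁻¹ • ψ‖ ≤ 1 := by
      rw [norm_smul, norm_inv, Complex.norm_real, Real.norm_of_nonneg (by positivity),
        inv_mul_le_one₀ (by positivity)]
      linarith
    have h0 := norm_le_zero_iff.1 ((norm_pairing_le u hφ hψ).trans hu.le)
    have hs : ∀ (a c : ℂ), pairing (a • φ) (c • ψ) = (a * c) • pairing φ ψ := by
      intro a c
      apply TensorProduct.ext'
      intro x y
      have h1 := pairing_tmul (a • φ) (c • ψ) x y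
      have h2 := pairing_tmul φ ψ x y
      refine h1.trans (Eq.trans ?_ (congrArg (fun z => (a * c) * z) h2).symm)
      simp only [smul_apply, smul_eq_mul]
      ring
    rw [hs, LinearMap.smul_apply, smul_eq_zero] at h0
    refine h0.resolve_left (mul_ne_zero (inv_ne_zero ?_) (inv_ne_zero ?_))
    · exact Complex.ofReal_ne_zero.2 (by positivity)
    · exact Complex.ofReal_ne_zero.2 (by positivity)

instance : NormedAddCommGroup (InjTensor E F) := NormedAddCommGroup.ofCore core

instance : NormedSpace ℂ (InjTensor E F) := NormedSpace.ofCore core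

end InjTensor

/-- The injective tensor product `E ⊗̂_ε F`: the completion of `E ⊗ F` for the injective norm. -/
abbrev InjTensorProduct (E F : Type*) [NormedAddCommGroup E] [NormedSpace ℂ E]
    [NormedAddCommGroup F] [NormedSpace ℂ F] : Type _ :=
  UniformSpace.Completion (InjTensor E F)

/-! ### The Schur property -/

/-- Every weakly convergent sequence converges in norm. -/
def HasSchurProperty (X : Type*) [NormedAddCommGroup X] [NormedSpace ℂ X] : Prop :=
  ∀ (x : ℕ → X) (a : X),
    (∀ φ : StrongDual ℂ X, Tendsto (fun n => φ (x n)) atTop (𝓝 (φ a))) → Tendsto x atTop (𝓝 a)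

/-! ### Vector measures and functions on a group with spectrum in a set of characters -/

section Spectrum

variable {G : Type*} [CommGroup G] [TopologicalSpace G] [MeasurableSpace G]
  {X : Type*} [NormedAddCommGroup X] [NormedSpace ℂ X]

/-- The Fourier coefficient `∫ conj γ dF` of a vector measure `F` at a character `γ`. -/
def measureFourierCoeff (F : VectorMeasure G X) (γ : PontryaginDual G) : X :=
  F.integral (fun g => (starRingEnd ℂ) (γ g : ℂ)) (ContinuousLinearMap.lsmul ℝ ℂ)

/-- The Fourier coefficient `∫ conj γ • f dμ` of a function `f` at a character `γ`. -/
def functionFourierCoeff (μ : Measure G) (f : G → X) (γ : PontryaginDual G) : X :=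
  ∫ g, (starRingEnd ℂ) (γ g : ℂ) • f g ∂μ

variable (X)

/-- `M_Λ(G, X)`: the countably additive `X`-valued measures of bounded variation whose Fourier
coefficients vanish off `Λ`. -/
def spectralMeasures (Λ : Set (PontryaginDual G)) : Set (VectorMeasure G X) :=
  {F | F.variation Set.univ < ∞ ∧ ∀ γ ∉ Λ, measureFourierCoeff F γ = 0}

/-- `M_{Λ,ac}(G, X)`: the members of `M_Λ(G, X)` that are absolutely continuous with respect
to `μ`. -/
def spectralMeasuresAC (μ : Measure G) (Λ : Set (PontryaginDual G)) :
    Set (VectorMeasure G X) :=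
  {F | F ∈ spectralMeasures X Λ ∧ ∀ A, MeasurableSet A → μ A = 0 → F A = 0}

/-- `M_Λ^∞(G, X)`: the members `F` of `M_Λ(G, X)` with `|F| ≤ C μ` for some constant `C`. -/
def spectralMeasuresBdd (μ : Measure G) (Λ : Set (PontryaginDual G)) :
    Set (VectorMeasure G X) :=
  {F | F ∈ spectralMeasures X Λ ∧ ∃ C : ℝ≥0, F.variation ≤ C • μ}

/-- `L^p_Λ(G, X)`, regarded as a space of measures by identifying a Bochner integrable function
`f` with the measure `A ↦ ∫_A f dμ`. -/
def spectralLp (p : ℝ≥0∞) (μ : Measure G) (Λ : Set (PontryaginDual G)) :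
    Set (VectorMeasure G X) :=
  {F | ∃ f : G → X, MemLp f p μ ∧ (∀ γ ∉ Λ, functionFourierCoeff μ f γ = 0) ∧
    F = μ.withDensityᵥ f}

variable {X}

/-- `Λ` is a Riesz set: `M_Λ(G, ℂ) = L^1_Λ(G, ℂ)`. -/
def IsRieszSet (μ : Measure G) (Λ : Set (PontryaginDual G)) : Prop :=
  spectralMeasures ℂ Λ = spectralLp ℂ 1 μ Λ

variable (X)

/-- The type I-`Λ`-Radon-Nikodym property: `M_Λ^∞(G, X) = L^∞_Λ(G, X)`. -/
def HasTypeIRNP (μ : Measure G) (Λ : Set (PontryaginDual G)) : Prop :=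
  spectralMeasuresBdd X μ Λ = spectralLp X ∞ μ Λ

/-- The type II-`Λ`-Radon-Nikodym property: `M_{Λ,ac}(G, X) = L^1_Λ(G, X)`. -/
def HasTypeIIRNP (μ : Measure G) (Λ : Set (PontryaginDual G)) : Prop :=
  spectralMeasuresAC X μ Λ = spectralLp X 1 μ Λ

end Spectrum

end

/-!
# Radon–Nikodym properties of `L¹ ⊗̂_ε X`

Write `Z = L¹ ⊗̂_ε X`. In any Banach space the two properties say that all measures of the relevant
class have Bochner integrable densities (`hasTypeIRNP_iff`, `hasTypeIIRNP_iff`). They pass from `Z`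
to `X` because `x ↦ 1 ⊗ x` embeds `X` as a complemented subspace
(`exists_density_of_tmulRight_one`).

Conversely let `F` be an absolutely continuous measure with values in `Z` and spectrum in `Λ`. It
has two kinds of slices: `(φ ⊗ id) F` with values in `X`, which have densities by assumption, and
`(id ⊗ ψ) F` with values in `L¹`, which have densities because `Λ` is a Riesz set
(`IsRieszSet.exists_density`). The Schur property of `X` glues these together
(`exists_density_injTensorProduct`). The topology of `G` has a countable basis; the finite algebras
generated by its first `n` members consist of unions of cells, and averaging in the first factor
over the cells of level `n` defines contractions of `Z` converging strongly to the identity. The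
average of `F` has a density `z n`, a finite combination of slices in `X`. For almost every point
`s`, the values at `s` of the densities of the slices `∫_A ⊗ id` of `F` form a bounded additive set
function with values in `X`. The slices in `L¹` make it absolutely continuous when tested against
countably many functionals, and the Schur property makes it absolutely continuous in norm
(`AdditiveOn.exists_delta`). Hence the images of `z n s` under all `id ⊗ ψ` are convergent
martingales in `L¹` (`cauchySeq_sum_smul_cellUnit`), and the Schur property, used a second time,
shows that `z n s` is Cauchy in `Z` (`InjTensorProduct.cauchySeq_of_sliceRight`). Since the norm of
`z n` is dominated by the density of the variation of `F`, the limit is a density of `F`.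

For a measure `ν` with values in `L¹` and spectrum in the Riesz set `Λ`, almost every `t` gives a
scalar set function `A ↦ ν A t` of bounded variation on the algebra of all cells. The averages of
this function over the cells have weak cluster points, which are complex measures with spectrum in
`Λ`, hence functions; these functions are densities of `A ↦ ν A t` for almost every `t`, so the
averages converge in mean. Dominated convergence in `t` then shows that the averages of `ν` form a
Cauchy sequence in `L¹(G, L¹)`.
-/

noncomputable section

/-! ### Slice maps on the injective tensor product -/

namespace InjTensor

variable {E F : Type*} [NormedAddCommGroup E] [NormedSpace ℂ E]
  [NormedAddCommGroup F] [NormedSpace ℂ F]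

theorem norm_pairing_le_mul (φ : StrongDual ℂ E) (ψ : StrongDual ℂ F) (u : InjTensor E F) :
    ‖pairing φ ψ u‖ ≤ ‖φ‖ * ‖ψ‖ * ‖u‖ := by
  have hs : ∀ (a c : ℂ), pairing (a • φ) (c • ψ) u = (a * c) * pairing φ ψ u := by
    intro a c
    have : pairing (a • φ) (c • ψ) = (a * c) • pairing φ ψ := by
      apply TensorProduct.ext'
      intro x y
      have h1 := pairing_tmul (a • φ) (c • ψ) x y
      have h2 := pairing_tmul φ ψ x y
      refine h1.trans (Eq.trans ?_ (congrArg (fun z => (a * c) * z) h2).symm)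
      simp only [smul_apply, smul_eq_mul]
      ring
    rw [this, LinearMap.smul_apply, smul_eq_mul]
  by_cases hφ : φ = 0
  · subst hφ
    have : pairing (0 : StrongDual ℂ E) ψ = 0 :=
      TensorProduct.ext' fun x y => (pairing_tmul 0 ψ x y).trans (by simp; rfl)
    simp [this]
  by_cases hψ : ψ = 0
  · subst hψ
    have : pairing φ (0 : StrongDual ℂ F) = 0 :=
      TensorProduct.ext' fun x y => (pairing_tmul φ 0 x y).trans (by simp; rfl)
    simp [this]
  have hφ' : ‖φ‖ ≠ 0 := norm_ne_zero_iff.2 hφ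
  have hψ' : ‖ψ‖ ≠ 0 := norm_ne_zero_iff.2 hψ
  have h := norm_pairing_le u (φ := (‖φ‖ : ℂ)⁻¹ • φ) (ψ := (‖ψ‖ : ℂ)⁻¹ • ψ)
    (by simp [norm_smul, hφ']) (by simp [norm_smul, hψ'])
  rw [hs, norm_mul, norm_mul, norm_inv, norm_inv, Complex.norm_real, Complex.norm_real,
    norm_norm, norm_norm, ← mul_inv, inv_mul_le_iff₀ (by positivity)] at h
  exact h

/-- The linear map `φ ⊗ id : E ⊗ F → F`. -/
def sliceLeft (φ : StrongDual ℂ E) : InjTensor E F →ₗ[ℂ] F :=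
  TensorProduct.lift ((LinearMap.lsmul ℂ F).comp φ.toLinearMap)

theorem sliceLeft_tmul (φ : StrongDual ℂ E) (x : E) (y : F) :
    sliceLeft φ (x ⊗ₜ[ℂ] y : E ⊗[ℂ] F) = φ x • y :=
  TensorProduct.lift.tmul x y

/-- The linear map `id ⊗ ψ : E ⊗ F → E`. -/
def sliceRight (ψ : StrongDual ℂ F) : InjTensor E F →ₗ[ℂ] E :=
  TensorProduct.lift ((LinearMap.lsmul ℂ E).comp ψ.toLinearMap).flip

theorem sliceRight_tmul (ψ : StrongDual ℂ F) (x : E) (y : F) :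
    sliceRight ψ (x ⊗ₜ[ℂ] y : E ⊗[ℂ] F) = ψ y • x :=
  TensorProduct.lift.tmul x y

theorem apply_sliceLeft (φ : StrongDual ℂ E) (ψ : StrongDual ℂ F) (u : InjTensor E F) :
    ψ (sliceLeft φ u) = pairing φ ψ u := by
  have : ψ.toLinearMap ∘ₗ sliceLeft φ = pairing φ ψ := by
    apply TensorProduct.ext'
    intro x y
    have h1 := sliceLeft_tmul (F := F) φ x y
    have h2 := pairing_tmul φ ψ x y
    refine (congrArg ψ h1).trans (Eq.trans ?_ h2.symm)
    simp
  exact LinearMap.congr_fun this u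

theorem apply_sliceRight (φ : StrongDual ℂ E) (ψ : StrongDual ℂ F) (u : InjTensor E F) :
    φ (sliceRight ψ u) = pairing φ ψ u := by
  have : φ.toLinearMap ∘ₗ sliceRight ψ = pairing φ ψ := by
    apply TensorProduct.ext'
    intro x y
    have h1 := sliceRight_tmul (E := E) ψ x y
    have h2 := pairing_tmul φ ψ x y
    refine (congrArg φ h1).trans (Eq.trans ?_ h2.symm)
    simp [mul_comm]
  exact LinearMap.congr_fun this u

theorem norm_sliceLeft_le (φ : StrongDual ℂ E) (u : InjTensor E F) :
    ‖sliceLeft φ u‖ ≤ ‖φ‖ * ‖u‖ := by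
  obtain ⟨ψ, hψ, h⟩ := exists_dual_vector'' ℂ (sliceLeft φ u)
  have h1 := norm_pairing_le_mul φ ψ u
  rw [← apply_sliceLeft, h, RCLike.norm_ofReal, abs_norm] at h1
  refine h1.trans ?_
  have := mul_le_mul_of_nonneg_left hψ (norm_nonneg φ)
  rw [mul_one] at this
  gcongr

theorem norm_sliceRight_le (ψ : StrongDual ℂ F) (u : InjTensor E F) :
    ‖sliceRight ψ u‖ ≤ ‖ψ‖ * ‖u‖ := by
  obtain ⟨φ, hφ, h⟩ := exists_dual_vector'' ℂ (sliceRight ψ u)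
  have h1 := norm_pairing_le_mul φ ψ u
  rw [← apply_sliceRight, h, RCLike.norm_ofReal, abs_norm] at h1
  refine h1.trans ?_
  have := mul_le_mul_of_nonneg_right hφ (norm_nonneg ψ)
  rw [one_mul] at this
  gcongr

theorem norm_le_of_pairing {u : InjTensor E F} {C : ℝ}
    (h : ∀ (φ : StrongDual ℂ E) (ψ : StrongDual ℂ F), ‖φ‖ ≤ 1 → ‖ψ‖ ≤ 1 →
      ‖pairing φ ψ u‖ ≤ C) : ‖u‖ ≤ C := by
  rw [norm_def]
  exact ciSup_le fun p => h _ _ p.1.2 p.2.2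

/-- The elementary tensor `x ⊗ y`, bundled as a linear map in `y`. -/
def tmul (x : E) : F →ₗ[ℂ] InjTensor E F := TensorProduct.mk ℂ E F x

theorem norm_tmul_le (x : E) (y : F) : ‖tmul x y‖ ≤ ‖x‖ * ‖y‖ := by
  refine norm_le_of_pairing fun φ ψ hφ hψ => ?_
  have h := pairing_tmul φ ψ x y
  refine (congrArg norm h).le.trans ?_
  rw [norm_mul]
  gcongr
  · exact (φ.le_of_opNorm_le hφ x).trans (by simp)
  · exact (ψ.le_of_opNorm_le hψ y).trans (by simp)

end InjTensor

namespace InjTensorProduct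

variable {E F : Type*} [NormedAddCommGroup E] [NormedSpace ℂ E]
  [NormedAddCommGroup F] [NormedSpace ℂ F]

/-- The canonical embedding of the algebraic tensor product into its completion. -/
abbrev incl : InjTensor E F →L[ℂ] InjTensorProduct E F := UniformSpace.Completion.toComplL

theorem denseRange_incl : DenseRange (incl : InjTensor E F →L[ℂ] InjTensorProduct E F) :=
  UniformSpace.Completion.denseRange_coe

theorem norm_incl (u : InjTensor E F) : ‖incl u‖ = ‖u‖ := UniformSpace.Completion.norm_coe u

/-- The operator `y ↦ x ⊗ y`. -/
def tmulRight (x : E) : F →L[ℂ] InjTensorProduct E F :=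
  incl.comp (LinearMap.mkContinuous (InjTensor.tmul x) ‖x‖ (InjTensor.norm_tmul_le x))

theorem norm_tmulRight_le (x : E) (y : F) : ‖tmulRight x y‖ ≤ ‖x‖ * ‖y‖ :=
  (norm_incl _).le.trans (InjTensor.norm_tmul_le x y)

/-- The operator `φ ⊗ id` on the injective tensor product. -/
def sliceLeft [CompleteSpace F] (φ : StrongDual ℂ E) : InjTensorProduct E F →L[ℂ] F :=
  (InjTensor.sliceLeft φ).extendOfNorm incl.toLinearMap

/-- The operator `id ⊗ ψ` on the injective tensor product. -/
def sliceRight [CompleteSpace E] (ψ : StrongDual ℂ F) : InjTensorProduct E F →L[ℂ] E :=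
  (InjTensor.sliceRight ψ).extendOfNorm incl.toLinearMap

theorem sliceLeft_incl [CompleteSpace F] (φ : StrongDual ℂ E) (u : InjTensor E F) :
    sliceLeft φ (incl u) = InjTensor.sliceLeft φ u :=
  LinearMap.extendOfNorm_eq denseRange_incl
    ⟨‖φ‖, fun x => (InjTensor.norm_sliceLeft_le φ x).trans_eq
      (congrArg _ (norm_incl x).symm)⟩ u

theorem sliceRight_incl [CompleteSpace E] (ψ : StrongDual ℂ F) (u : InjTensor E F) :
    sliceRight ψ (incl u) = InjTensor.sliceRight ψ u :=
  LinearMap.extendOfNorm_eq denseRange_incl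
    ⟨‖ψ‖, fun x => (InjTensor.norm_sliceRight_le ψ x).trans_eq
      (congrArg _ (norm_incl x).symm)⟩ u

theorem norm_sliceLeft_le [CompleteSpace F] (φ : StrongDual ℂ E) (z : InjTensorProduct E F) :
    ‖sliceLeft φ z‖ ≤ ‖φ‖ * ‖z‖ :=
  LinearMap.norm_extendOfNorm_apply_le denseRange_incl ‖φ‖
    (fun x => (InjTensor.norm_sliceLeft_le φ x).trans_eq
      (congrArg _ (norm_incl x).symm)) z

theorem sliceLeft_tmulRight [CompleteSpace F] (φ : StrongDual ℂ E) (x : E) (y : F) :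
    sliceLeft φ (tmulRight x y) = φ x • y :=
  (sliceLeft_incl φ _).trans (InjTensor.sliceLeft_tmul φ x y)

theorem sliceRight_tmulRight [CompleteSpace E] (ψ : StrongDual ℂ F) (x : E) (y : F) :
    sliceRight ψ (tmulRight x y) = ψ y • x :=
  (sliceRight_incl ψ _).trans (InjTensor.sliceRight_tmul ψ x y)

/-- Two continuous linear maps on the injective tensor product that agree on elementary tensors
are equal. -/
theorem clm_ext {Y : Type*} [NormedAddCommGroup Y] [NormedSpace ℂ Y]
    {S T : InjTensorProduct E F →L[ℂ] Y} (h : ∀ x y, S (tmulRight x y) = T (tmulRight x y)) :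
    S = T := by
  have : S.toLinearMap ∘ₗ incl.toLinearMap = T.toLinearMap ∘ₗ incl.toLinearMap :=
    TensorProduct.ext' h
  exact ContinuousLinearMap.coeFn_injective <|
    denseRange_incl.equalizer S.continuous T.continuous (funext fun u => LinearMap.congr_fun this u)

theorem apply_sliceLeft_eq [CompleteSpace E] [CompleteSpace F] (φ : StrongDual ℂ E)
    (ψ : StrongDual ℂ F) (z : InjTensorProduct E F) :
    ψ (sliceLeft φ z) = φ (sliceRight ψ z) := by
  have : ψ.comp (sliceLeft φ) = φ.comp (sliceRight ψ) :=
    clm_ext fun x y => by simp [sliceLeft_tmulRight, sliceRight_tmulRight, mul_comm]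
  exact congrArg (fun T => T z) this

/-- The injective norm is attained up to `ε` on functionals `φ ⊗ ψ`, hence on `φ ⊗ id`. -/
theorem exists_norm_sliceLeft [CompleteSpace F] (z : InjTensorProduct E F) {ε : ℝ} (hε : 0 < ε) :
    ∃ φ : StrongDual ℂ E, ‖φ‖ ≤ 1 ∧ ‖z‖ - ε ≤ ‖sliceLeft (F := F) φ z‖ := by
  by_contra! hc
  obtain ⟨w, hw⟩ : ∃ u : InjTensor E F, ‖z - incl u‖ < ε / 4 := by
    have := Metric.mem_closure_range_iff.1 (denseRange_incl z) (ε / 4) (by positivity)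
    simpa [dist_eq_norm] using this
  have h1 : ‖w‖ ≤ ‖z‖ - ε + ε / 4 := by
    refine InjTensor.norm_le_of_pairing fun φ ψ hφ hψ => ?_
    rw [← InjTensor.apply_sliceLeft]
    have h2 : ‖InjTensor.sliceLeft φ w‖ ≤ ‖z‖ - ε + ε / 4 := by
      rw [← sliceLeft_incl]
      have : sliceLeft (F := F) φ (incl w) = sliceLeft φ z - sliceLeft φ (z - incl w) := by
        simp
      rw [this]
      refine (norm_sub_le _ _).trans (add_le_add (hc φ hφ).le ?_)
      refine (norm_sliceLeft_le φ _).trans ?_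
      calc ‖φ‖ * ‖z - incl w‖ ≤ 1 * (ε / 4) := by gcongr
        _ = ε / 4 := one_mul _
    exact (ψ.le_of_opNorm_le hψ _).trans ((one_mul _).le.trans h2)
  have h3 : ‖z‖ ≤ ‖w‖ + ‖z - incl w‖ := by
    rw [← norm_incl w]
    simpa using norm_add_le (incl w) (z - incl w)
  linarith

theorem norm_le_of_sliceLeft [CompleteSpace F] {z : InjTensorProduct E F} {C : ℝ}
    (h : ∀ φ : StrongDual ℂ E, ‖φ‖ ≤ 1 → ‖sliceLeft (F := F) φ z‖ ≤ C) : ‖z‖ ≤ C := by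
  refine le_of_forall_pos_le_add fun ε hε => ?_
  obtain ⟨φ, hφ, h1⟩ := exists_norm_sliceLeft z hε
  linarith [h φ hφ]

/-- If `F` has the Schur property, a sequence in `E ⊗̂_ε F` is Cauchy as soon as its images under
all the operators `id ⊗ ψ` are Cauchy. Otherwise differences `d k = z (n k) - z (m k)` bounded
below in norm are seen by functionals `φ k` in the dual unit ball, and `(φ k ⊗ id) (d k)` is weakly
null without being norm null. -/
theorem cauchySeq_of_sliceRight [CompleteSpace E] [CompleteSpace F] (hF : HasSchurProperty F)
    (z : ℕ → InjTensorProduct E F)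
    (h : ∀ ψ : StrongDual ℂ F, CauchySeq fun n => sliceRight (E := E) ψ (z n)) :
    CauchySeq z := by
  rw [Metric.cauchySeq_iff]
  by_contra! hc
  obtain ⟨ε, hε, hc⟩ := hc
  choose m hm n hn hmn using hc
  have h1 : ∀ k, ∃ φ : StrongDual ℂ E, ‖φ‖ ≤ 1 ∧
      ‖z (m k) - z (n k)‖ - ε / 2 ≤ ‖sliceLeft (F := F) φ (z (m k) - z (n k))‖ :=
    fun k => exists_norm_sliceLeft _ (by positivity)
  choose φ hφ hφz using h1
  have h2 : Tendsto (fun k => sliceLeft (F := F) (φ k) (z (m k) - z (n k))) atTop (𝓝 0) := by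
    refine hF _ _ fun ψ => ?_
    rw [map_zero]
    simp only [apply_sliceLeft_eq]
    have h3 : Tendsto (fun k => ‖sliceRight (E := E) ψ (z (m k) - z (n k))‖) atTop (𝓝 0) := by
      have hm' : Tendsto m atTop atTop := tendsto_atTop_mono hm tendsto_id
      have hn' : Tendsto n atTop atTop := tendsto_atTop_mono hn tendsto_id
      have h4 := (cauchySeq_iff_tendsto_dist_atTop_0.1 (h ψ)).comp
        ((hm'.prodMk hn').mono_right prod_atTop_atTop_eq.le)
      simpa [Function.comp_def, dist_eq_norm] using h4
    refine squeeze_zero_norm (fun k => ?_) h3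
    exact ((φ k).le_of_opNorm_le (hφ k) _).trans (one_mul _).le
  obtain ⟨k, hk⟩ := ((tendsto_norm_zero.comp h2).eventually (gt_mem_nhds (half_pos hε))).exists
  have h5 := hmn k
  rw [dist_eq_norm] at h5
  have h6 := hφz k
  simp only [Function.comp] at hk
  linarith

end InjTensorProduct

/-! ### Cells of a sequence of sets -/

section Cells

variable {α : Type*}

/-- The record, for the first `n` sets of a sequence `U`, of which of them contain `x`. The fibres
of `code U n` are the atoms of the algebra generated by `U 0, …, U (n - 1)`. -/
def code (U : ℕ → Set α) (n : ℕ) (x : α) : Fin n → Bool := by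
  classical exact fun i => decide (x ∈ U i)

/-- The atoms of the algebra generated by `U 0, …, U (n - 1)`; some of them may be empty. -/
def cell (U : ℕ → Set α) (n : ℕ) (c : Fin n → Bool) : Set α := code U n ⁻¹' {c}

/-- The algebra of sets generated by the sequence `U`. -/
def cellAlgebra (U : ℕ → Set α) : Set (Set α) := {A | ∃ n, ∃ S : Set (Fin n → Bool),
  A = code U n ⁻¹' S}

variable {U : ℕ → Set α}

theorem code_apply {n : ℕ} {x : α} {i : Fin n} : code U n x i = true ↔ x ∈ U i := by
  simp [code]

theorem code_castLE {m n : ℕ} (h : m ≤ n) (x : α) :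
    (fun i => code U n x (Fin.castLE h i)) = code U m x := rfl

theorem exists_level {A : Set α} (hA : A ∈ cellAlgebra U) :
    ∃ n, ∀ k ≥ n, ∃ S : Set (Fin k → Bool), A = code U k ⁻¹' S := by
  obtain ⟨n, S, rfl⟩ := hA
  exact ⟨n, fun k hk => ⟨{c | (fun i => c (Fin.castLE hk i)) ∈ S}, rfl⟩⟩

theorem preimage_mem_cellAlgebra (n : ℕ) (S : Set (Fin n → Bool)) :
    code U n ⁻¹' S ∈ cellAlgebra U := ⟨n, S, rfl⟩

theorem cell_mem_cellAlgebra (n : ℕ) (c : Fin n → Bool) : cell U n c ∈ cellAlgebra U :=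
  preimage_mem_cellAlgebra n _

theorem mem_cellAlgebra (i : ℕ) : U i ∈ cellAlgebra U := by
  refine ⟨i + 1, {c | c (Fin.last i) = true}, ?_⟩
  ext x
  simp [code_apply]

theorem empty_mem_cellAlgebra : ∅ ∈ cellAlgebra U := ⟨0, ∅, rfl⟩

theorem univ_mem_cellAlgebra : Set.univ ∈ cellAlgebra U := ⟨0, Set.univ, rfl⟩

theorem compl_mem_cellAlgebra {A : Set α} (hA : A ∈ cellAlgebra U) : Aᶜ ∈ cellAlgebra U := by
  obtain ⟨n, S, rfl⟩ := hA
  exact ⟨n, Sᶜ, rfl⟩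

theorem inter_mem_cellAlgebra {A B : Set α} (hA : A ∈ cellAlgebra U) (hB : B ∈ cellAlgebra U) :
    A ∩ B ∈ cellAlgebra U := by
  obtain ⟨n, hn⟩ := exists_level hA
  obtain ⟨m, hm⟩ := exists_level hB
  obtain ⟨S, hS⟩ := hn (max n m) (le_max_left _ _)
  obtain ⟨T, hT⟩ := hm (max n m) (le_max_right _ _)
  exact ⟨max n m, S ∩ T, by conv_lhs => rw [hS, hT, ← Set.preimage_inter]⟩

theorem union_mem_cellAlgebra {A B : Set α} (hA : A ∈ cellAlgebra U) (hB : B ∈ cellAlgebra U) :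
    A ∪ B ∈ cellAlgebra U := by
  have := compl_mem_cellAlgebra
    (inter_mem_cellAlgebra (compl_mem_cellAlgebra hA) (compl_mem_cellAlgebra hB))
  rwa [Set.compl_inter, compl_compl, compl_compl] at this

theorem sdiff_mem_cellAlgebra {A B : Set α} (hA : A ∈ cellAlgebra U) (hB : B ∈ cellAlgebra U) :
    A \ B ∈ cellAlgebra U :=
  inter_mem_cellAlgebra hA (compl_mem_cellAlgebra hB)

theorem biUnion_mem_cellAlgebra {ι : Type*} (s : Finset ι) {A : ι → Set α}
    (hA : ∀ i, A i ∈ cellAlgebra U) : ⋃ i ∈ s, A i ∈ cellAlgebra U := by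
  classical
  induction s using Finset.induction_on with
  | empty => simpa using empty_mem_cellAlgebra
  | insert i s _ ih =>
    rw [Finset.set_biUnion_insert]
    exact union_mem_cellAlgebra (hA i) ih

theorem biInter_mem_cellAlgebra {ι : Type*} (s : Finset ι) {A : ι → Set α}
    (hA : ∀ i, A i ∈ cellAlgebra U) : ⋂ i ∈ s, A i ∈ cellAlgebra U := by
  have := compl_mem_cellAlgebra
    (biUnion_mem_cellAlgebra s fun i => compl_mem_cellAlgebra (hA i))
  simpa [Set.compl_iUnion] using this

theorem countable_cellAlgebra : (cellAlgebra U).Countable := by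
  have : cellAlgebra U = ⋃ n, Set.range fun S : Set (Fin n → Bool) => code U n ⁻¹' S := by
    ext A
    simp [cellAlgebra, eq_comm]
  rw [this]
  exact Set.countable_iUnion fun n => Set.countable_range _

theorem measurable_code [MeasurableSpace α] (hU : ∀ i, MeasurableSet (U i)) (n : ℕ) :
    Measurable (code U n) := by
  refine measurable_pi_iff.2 fun i => measurable_to_bool ?_
  have : (fun x => code U n x i) ⁻¹' {true} = U i := by
    ext x
    simp [code_apply]
  rw [this]
  exact hU i

theorem measurableSet_of_mem_cellAlgebra [MeasurableSpace α] (hU : ∀ i, MeasurableSet (U i))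
    {A : Set α} (hA : A ∈ cellAlgebra U) : MeasurableSet A := by
  obtain ⟨n, S, rfl⟩ := hA
  exact measurable_code hU n (Set.toFinite S).measurableSet

theorem measurableSet_cell [MeasurableSpace α] (hU : ∀ i, MeasurableSet (U i)) (n : ℕ)
    (c : Fin n → Bool) : MeasurableSet (cell U n c) :=
  measurableSet_of_mem_cellAlgebra hU (cell_mem_cellAlgebra n c)

theorem isPiSystem_cellAlgebra : IsPiSystem (cellAlgebra U) :=
  fun _ hA _ hB _ => inter_mem_cellAlgebra hA hB

theorem generateFrom_cellAlgebra [TopologicalSpace α] [mα : MeasurableSpace α] [BorelSpace α]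
    (hU : TopologicalSpace.IsTopologicalBasis (Set.range U)) :
    mα = MeasurableSpace.generateFrom (cellAlgebra U) := by
  have := hU.secondCountableTopology (Set.countable_range U)
  apply le_antisymm
  · rw [BorelSpace.measurable_eq (α := α), hU.borel_eq_generateFrom]
    refine MeasurableSpace.generateFrom_mono ?_
    rintro _ ⟨i, rfl⟩
    exact mem_cellAlgebra i
  · exact MeasurableSpace.generateFrom_le fun A hA =>
      measurableSet_of_mem_cellAlgebra (fun i => (hU.isOpen ⟨i, rfl⟩).measurableSet) hA

/-- Every continuous function on a compact space is uniformly close to a function of finitely many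
membership relations in the members of a given basis. -/
theorem exists_step_approx [TopologicalSpace α] [CompactSpace α] {Y : Type*}
    [NormedAddCommGroup Y] (hU : TopologicalSpace.IsTopologicalBasis (Set.range U)) {f : α → Y}
    (hf : Continuous f) {ε : ℝ} (hε : 0 < ε) :
    ∃ M, ∃ g : (Fin M → Bool) → Y, ∀ x, ‖f x - g (code U M x)‖ ≤ ε := by
  have h1 : ∀ x : α, ∃ i, x ∈ U i ∧ U i ⊆ f ⁻¹' Metric.ball (f x) (ε / 2) := fun x => by
    obtain ⟨_, ⟨i, rfl⟩, hx, hi⟩ := hU.exists_subset_of_mem_open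
      (show x ∈ f ⁻¹' Metric.ball (f x) (ε / 2) by simp [hε])
      (Metric.isOpen_ball.preimage hf)
    exact ⟨i, hx, hi⟩
  choose i hxi hi using h1
  obtain ⟨t, ht⟩ := isCompact_univ.elim_finite_subcover (fun x => U (i x))
    (fun x => hU.isOpen ⟨_, rfl⟩) (fun x _ => Set.mem_iUnion.2 ⟨x, hxi x⟩)
  classical
  let M := t.sup i + 1
  refine ⟨M, fun c => if h : ∃ y, code U M y = c then f h.choose else 0, fun x => ?_⟩
  have hex : ∃ y, code U M y = code U M x := ⟨x, rfl⟩
  beta_reduce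
  rw [dif_pos hex]
  obtain ⟨z, hz, hxz⟩ := Set.mem_iUnion₂.1 (ht (Set.mem_univ x))
  have hzM : i z < M := Nat.lt_succ_of_le (Finset.le_sup hz)
  have hy : hex.choose ∈ U (i z) := by
    have := congrFun hex.choose_spec ⟨i z, hzM⟩
    exact code_apply.1 (this.trans (code_apply.2 hxz))
  have d1 := hi z hxz
  have d2 := hi z hy
  rw [Set.mem_preimage, Metric.mem_ball] at d1 d2
  rw [← dist_eq_norm]
  linarith [dist_triangle_right (f x) (f hex.choose) (f z)]

/-! ### Finitely additive set functions on the algebra of cells -/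

variable {Y : Type*} [AddCommGroup Y]

/-- Finite additivity on the algebra generated by `U`. -/
def AdditiveOn (U : ℕ → Set α) (m : Set α → Y) : Prop :=
  ∀ A ∈ cellAlgebra U, ∀ B ∈ cellAlgebra U, Disjoint A B → m (A ∪ B) = m A + m B

namespace AdditiveOn

variable {m : Set α → Y}

theorem empty (hm : AdditiveOn U m) : m ∅ = 0 := by
  have := hm ∅ empty_mem_cellAlgebra ∅ empty_mem_cellAlgebra (by simp)
  simpa using this

theorem sdiff (hm : AdditiveOn U m) {A B : Set α} (hA : A ∈ cellAlgebra U)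
    (hB : B ∈ cellAlgebra U) : m A = m (A ∩ B) + m (A \ B) := by
  rw [← hm _ (inter_mem_cellAlgebra hA hB) _ (sdiff_mem_cellAlgebra hA hB)
    Set.disjoint_sdiff_inter.symm, Set.inter_union_sdiff]

theorem biUnion (hm : AdditiveOn U m) {ι : Type*} (s : Finset ι) {A : ι → Set α}
    (hA : ∀ i, A i ∈ cellAlgebra U) (hd : Pairwise (Function.onFun Disjoint A)) :
    m (⋃ i ∈ s, A i) = ∑ i ∈ s, m (A i) := by
  classical
  induction s using Finset.induction_on with
  | empty => simpa using hm.empty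
  | insert i s hi ih =>
    rw [Finset.set_biUnion_insert, Finset.sum_insert hi, ← ih]
    refine hm _ (hA i) _ (biUnion_mem_cellAlgebra s hA) ?_
    refine Set.disjoint_iUnion₂_right.2 fun j hj => hd ?_
    rintro rfl
    exact hi hj

theorem preimage (hm : AdditiveOn U m) {n : ℕ} (S : Finset (Fin n → Bool)) :
    m (code U n ⁻¹' S) = ∑ c ∈ S, m (cell U n c) := by
  rw [← hm.biUnion S (fun c => cell_mem_cellAlgebra n c)]
  · congr 1
    ext x
    simp [cell]
  · exact fun c d hcd => Disjoint.preimage _ (by simpa using hcd)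

theorem cell_eq_sum (hm : AdditiveOn U m) {k n : ℕ} (h : k ≤ n) (c : Fin k → Bool) :
    m (cell U k c) =
      ∑ d : Fin n → Bool with (fun i => d (Fin.castLE h i)) = c, m (cell U n d) := by
  rw [← hm.preimage]
  congr 1
  ext x
  simp [cell, code_castLE]

theorem map (hm : AdditiveOn U m) {Y' : Type*} [AddCommGroup Y'] (T : Y →+ Y') :
    AdditiveOn U fun A => T (m A) := fun A hA B hB h => by
  simp only [hm A hA B hB h, map_add]

/-- The variation over the cells increases with the level. -/
theorem sum_enorm_mono {Y : Type*} [NormedAddCommGroup Y] {m : Set α → Y} (hm : AdditiveOn U m) :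
    Monotone fun n => ∑ c, ‖m (cell U n c)‖ₑ := by
  intro k n h
  calc ∑ c, ‖m (cell U k c)‖ₑ
      ≤ ∑ c, ∑ d : Fin n → Bool with (fun i => d (Fin.castLE h i)) = c, ‖m (cell U n d)‖ₑ := by
        gcongr with c
        rw [hm.cell_eq_sum h]
        exact enorm_sum_le _ _
    _ = ∑ d, ‖m (cell U n d)‖ₑ := Finset.sum_fiberwise _ _ _

end AdditiveOn

end Cells

/-! ### Averages over cells -/

section Averages

variable {α : Type*} [MeasurableSpace α] {U : ℕ → Set α} {μ : Measure α}
  {Y : Type*} [NormedAddCommGroup Y]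

theorem stronglyMeasurable_comp_code (hU : ∀ i, MeasurableSet (U i)) {n : ℕ}
    (g : (Fin n → Bool) → Y) : StronglyMeasurable fun x => g (code U n x) :=
  (StronglyMeasurable.of_discrete (f := g)).comp_measurable (measurable_code hU n)

theorem memLp_comp_code [IsFiniteMeasure μ] (hU : ∀ i, MeasurableSet (U i)) {n : ℕ}
    (g : (Fin n → Bool) → Y) (p : ℝ≥0∞) : MemLp (fun x => g (code U n x)) p μ := by
  refine MemLp.of_bound (stronglyMeasurable_comp_code hU g).aestronglyMeasurable (∑ c, ‖g c‖)
    (Eventually.of_forall fun x => ?_)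
  exact Finset.single_le_sum (f := fun c => ‖g c‖) (fun c _ => norm_nonneg _)
    (Finset.mem_univ (code U n x))

theorem integrable_comp_code [IsFiniteMeasure μ] (hU : ∀ i, MeasurableSet (U i)) {n : ℕ}
    (g : (Fin n → Bool) → Y) : Integrable (fun x => g (code U n x)) μ :=
  memLp_one_iff_integrable.1 (memLp_comp_code hU g 1)

theorem lintegral_comp_code (hU : ∀ i, MeasurableSet (U i)) {n : ℕ}
    (g : (Fin n → Bool) → ℝ≥0∞) :
    ∫⁻ x, g (code U n x) ∂μ = ∑ c, g c * μ (cell U n c) := by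
  rw [← lintegral_map (f := g) (measurable_of_countable g) (measurable_code hU n),
    lintegral_fintype]
  refine Finset.sum_congr rfl fun c _ => ?_
  rw [Measure.map_apply (measurable_code hU n) (measurableSet_singleton c), cell]

theorem ae_measure_cell_ne_zero (n : ℕ) :
    ∀ᵐ x ∂μ, μ (cell U n (code U n x)) ≠ 0 := by
  have h : {x | ¬ μ (cell U n (code U n x)) ≠ 0} ⊆
      ⋃ c ∈ {c : Fin n → Bool | μ (cell U n c) = 0}, cell U n c := by
    intro x hx
    simp only [ne_eq, not_not, Set.mem_ofPred_eq] at hx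
    exact Set.mem_biUnion (x := code U n x) hx rfl
  exact measure_mono_null h ((measure_biUnion_null_iff (Set.to_countable _)).2 fun c hc => hc)

variable [NormedSpace ℝ Y]

theorem integral_comp_code [CompleteSpace Y] [IsFiniteMeasure μ] (hU : ∀ i, MeasurableSet (U i))
    {n : ℕ} (g : (Fin n → Bool) → Y) :
    ∫ x, g (code U n x) ∂μ = ∑ c, μ.real (cell U n c) • g c := by
  rw [← integral_map (f := g) (measurable_code hU n).aemeasurable
    (StronglyMeasurable.of_discrete).aestronglyMeasurable, integral_fintype]
  · refine Finset.sum_congr rfl fun c _ => ?_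
    rw [map_measureReal_apply (measurable_code hU n) (measurableSet_singleton c), cell]
  · exact Integrable.of_finite

theorem setIntegral_comp_code [CompleteSpace Y] [IsFiniteMeasure μ]
    (hU : ∀ i, MeasurableSet (U i)) {n : ℕ} (g : (Fin n → Bool) → Y)
    (S : Finset (Fin n → Bool)) :
    ∫ x in code U n ⁻¹' S, g (code U n x) ∂μ = ∑ c ∈ S, μ.real (cell U n c) • g c := by
  classical
  rw [← integral_indicator (measurable_code hU n (Set.toFinite _).measurableSet)]
  have : (code U n ⁻¹' (S : Set (Fin n → Bool))).indicator (fun x => g (code U n x)) =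
      fun x => (fun c => if c ∈ S then g c else 0) (code U n x) := by
    ext x
    simp [Set.indicator_apply]
  rw [this, integral_comp_code hU]
  simp [Finset.sum_ite_mem]

/-- The function that takes on each cell of level `n` the average value of the set function `m`
there. On null cells it is `0`, because the factor `(μ.real _)⁻¹` is. -/
def cellAvg (μ : Measure α) (U : ℕ → Set α) (m : Set α → Y) (n : ℕ) (x : α) : Y :=
  (μ.real (cell U n (code U n x)))⁻¹ • m (cell U n (code U n x))

theorem integrable_cellAvg [IsFiniteMeasure μ] (hU : ∀ i, MeasurableSet (U i)) (m : Set α → Y)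
    (n : ℕ) : Integrable (cellAvg μ U m n) μ :=
  integrable_comp_code hU fun c => (μ.real (cell U n c))⁻¹ • m (cell U n c)

theorem setIntegral_cellAvg [CompleteSpace Y] [IsFiniteMeasure μ] (hU : ∀ i, MeasurableSet (U i))
    {m : Set α → Y} (hm : AdditiveOn U m) {n : ℕ}
    (h0 : ∀ c, μ (cell U n c) = 0 → m (cell U n c) = 0) (S : Set (Fin n → Bool)) :
    ∫ x in code U n ⁻¹' S, cellAvg μ U m n x ∂μ = m (code U n ⁻¹' S) := by
  obtain ⟨S, rfl⟩ := (Set.toFinite S).exists_finset_coe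
  rw [hm.preimage]
  refine (setIntegral_comp_code hU
    (fun c => (μ.real (cell U n c))⁻¹ • m (cell U n c)) S).trans ?_
  refine Finset.sum_congr rfl fun c _ => ?_
  by_cases hc : μ (cell U n c) = 0
  · simp [h0 c hc]
  · rw [smul_inv_smul₀]
    rwa [Ne, measureReal_eq_zero_iff]

theorem lintegral_enorm_cellAvg_le [IsFiniteMeasure μ] (hU : ∀ i, MeasurableSet (U i))
    (m : Set α → Y) (n : ℕ) :
    ∫⁻ x, ‖cellAvg μ U m n x‖ₑ ∂μ ≤ ∑ c, ‖m (cell U n c)‖ₑ := by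
  refine (lintegral_comp_code hU
    (fun c => ‖(μ.real (cell U n c))⁻¹ • m (cell U n c)‖ₑ)).trans_le ?_
  gcongr with c
  by_cases hc : μ (cell U n c) = 0
  · simp [hc]
  · rw [enorm_smul, mul_right_comm]
    have : ‖(μ.real (cell U n c))⁻¹‖ₑ * μ (cell U n c) = 1 := by
      rw [enorm_inv (by rwa [Ne, measureReal_eq_zero_iff]),
        Real.enorm_of_nonneg measureReal_nonneg, ofReal_measureReal,
        ENNReal.inv_mul_cancel hc (measure_ne_top _ _)]
    rw [this, one_mul]

end Averages

section L1Averages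

variable {α : Type*} [MeasurableSpace α] {U : ℕ → Set α} {μ : Measure α}

theorem eLpNorm_cellAvg_setIntegral_le [IsFiniteMeasure μ] (hU : ∀ i, MeasurableSet (U i))
    (w : α → ℂ) (n : ℕ) :
    eLpNorm (cellAvg μ U (fun A => ∫ x in A, w x ∂μ) n) 1 μ ≤ eLpNorm w 1 μ := by
  rw [eLpNorm_one_eq_lintegral_enorm, eLpNorm_one_eq_lintegral_enorm]
  refine (lintegral_enorm_cellAvg_le hU _ n).trans ?_
  calc ∑ c, ‖∫ x in cell U n c, w x ∂μ‖ₑ ≤ ∑ c, ∫⁻ x in cell U n c, ‖w x‖ₑ ∂μ := by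
        gcongr
        exact enorm_integral_le_lintegral_enorm _
    _ = ∫⁻ x in ⋃ c ∈ (Finset.univ : Finset (Fin n → Bool)), cell U n c, ‖w x‖ₑ ∂μ := by
        rw [lintegral_biUnion_finset]
        · exact fun c _ d _ hcd => Disjoint.preimage _ (by simpa using hcd)
        · exact fun c _ => measurableSet_cell hU n c
    _ ≤ ∫⁻ x, ‖w x‖ₑ ∂μ := setLIntegral_le_lintegral _ _

theorem cellAvg_setIntegral_sub {v w : α → ℂ} (hv : Integrable v μ) (hw : Integrable w μ) (n : ℕ) :
    cellAvg μ U (fun A => ∫ x in A, (v - w) x ∂μ) n =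
      cellAvg μ U (fun A => ∫ x in A, v x ∂μ) n - cellAvg μ U (fun A => ∫ x in A, w x ∂μ) n := by
  ext x
  simp only [cellAvg, Pi.sub_apply]
  rw [integral_sub hv.integrableOn hw.integrableOn, smul_sub]

/-- The averages of an integrable function over the cells converge to it in mean. -/
theorem tendsto_eLpNorm_cellAvg_sub [TopologicalSpace α] [CompactSpace α] [R1Space α] [BorelSpace α]
    [μ.WeaklyRegular]
    [IsProbabilityMeasure μ] (hU : TopologicalSpace.IsTopologicalBasis (Set.range U))
    {w : α → ℂ} (hw : Integrable w μ) :
    Tendsto (fun n => eLpNorm (cellAvg μ U (fun A => ∫ x in A, w x ∂μ) n - w) 1 μ) atTop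
      (𝓝 0) := by
  have hUm : ∀ i, MeasurableSet (U i) := fun i => (hU.isOpen ⟨i, rfl⟩).measurableSet
  rw [ENNReal.tendsto_nhds_zero]
  intro ε hε
  obtain ⟨δ, hδ0, hδ⟩ : ∃ δ : ℝ, 0 < δ ∧ ENNReal.ofReal δ ≤ ε / 4 := by
    obtain ⟨δ, h0, h⟩ := ENNReal.lt_iff_exists_real_btwn.1
      (ENNReal.div_pos hε.ne' (by simp : (4 : ℝ≥0∞) ≠ ∞))
    exact ⟨δ, by simpa using h.1, h.2.le⟩
  obtain ⟨v, hv, -⟩ := (memLp_one_iff_integrable.2 hw).exists_boundedContinuous_eLpNorm_sub_le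
    (by simp) (ENNReal.ofReal_pos.2 hδ0).ne'
  obtain ⟨M, g, hg⟩ := exists_step_approx hU v.continuous hδ0
  set s : α → ℂ := fun x => g (code U M x) with hs
  have hsi : Integrable s μ := integrable_comp_code hUm g
  have hvi : Integrable v μ := v.integrable μ
  have hws : eLpNorm (w - s) 1 μ ≤ ε / 2 := by
    have h1 : w - s = (w - v) + (v - s) := by abel
    have h2 : eLpNorm (⇑v - s) 1 μ ≤ ENNReal.ofReal δ := by
      refine (eLpNorm_le_of_ae_bound (C := δ) (Eventually.of_forall hg)).trans ?_
      simp
    rw [h1]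
    refine (eLpNorm_add_le (hw.sub hvi).aestronglyMeasurable (hvi.sub hsi).aestronglyMeasurable
      le_rfl).trans ?_
    calc _ ≤ ε / 4 + ε / 4 := add_le_add (hv.trans hδ) (h2.trans hδ)
      _ = ε / 2 := by
        rw [← ENNReal.add_div, ← two_mul, show (4 : ℝ≥0∞) = 2 * 2 by norm_num,
          ENNReal.mul_div_mul_left _ _ (by simp) (by simp)]
  filter_upwards [eventually_ge_atTop M] with n hn
  have hsn : cellAvg μ U (fun A => ∫ x in A, s x ∂μ) n =ᵐ[μ] s := by
    filter_upwards [ae_measure_cell_ne_zero (μ := μ) n] with x hx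
    have h1 : ∫ y in cell U n (code U n x), s y ∂μ = μ.real (cell U n (code U n x)) • s x := by
      rw [← setIntegral_const]
      refine setIntegral_congr_fun (measurableSet_cell hUm n _) fun y hy => ?_
      have hy' : code U n y = code U n x := hy
      simp only [hs, ← code_castLE hn, hy']
    rw [cellAvg, h1, inv_smul_smul₀]
    rwa [Ne, measureReal_eq_zero_iff]
  have h1 : cellAvg μ U (fun A => ∫ x in A, w x ∂μ) n - w =ᵐ[μ]
      cellAvg μ U (fun A => ∫ x in A, (w - s) x ∂μ) n + (s - w) := by
    filter_upwards [hsn] with x hx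
    rw [cellAvg_setIntegral_sub hw hsi]
    simp [hx]
  rw [eLpNorm_congr_ae h1]
  refine (eLpNorm_add_le (integrable_cellAvg hUm _ n).aestronglyMeasurable
    (hsi.sub hw).aestronglyMeasurable le_rfl).trans ?_
  rw [eLpNorm_sub_comm s w]
  calc _ ≤ ε / 2 + ε / 2 :=
        add_le_add ((eLpNorm_cellAvg_setIntegral_le hUm _ n).trans hws) hws
    _ = ε := ENNReal.add_halves ε

/-- The functional `w ↦ ∫_A w` on `L¹`. -/
def integralOn (μ : Measure α) (A : Set α) : StrongDual ℂ (Lp ℂ 1 μ) :=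
  LinearMap.mkContinuous
    { toFun := fun w => ∫ x in A, w x ∂μ
      map_add' := fun v w => by
        rw [← integral_add (L1.integrable_coeFn v).integrableOn
          (L1.integrable_coeFn w).integrableOn]
        exact integral_congr_ae (ae_restrict_of_ae (Lp.coeFn_add v w))
      map_smul' := fun a w => by
        rw [RingHom.id_apply, ← integral_smul]
        exact integral_congr_ae (ae_restrict_of_ae (Lp.coeFn_smul a w)) } 1 fun w => by
    rw [one_mul, L1.norm_eq_integral_norm]
    exact (norm_integral_le_integral_norm _).trans (setIntegral_le_integral
      (L1.integrable_coeFn w).norm (Eventually.of_forall fun x => norm_nonneg _))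

theorem integralOn_apply (A : Set α) (w : Lp ℂ 1 μ) : integralOn μ A w = ∫ x in A, w x ∂μ := rfl

theorem norm_integralOn_le (A : Set α) : ‖integralOn μ A‖ ≤ 1 :=
  LinearMap.mkContinuous_norm_le _ zero_le_one _

variable [IsFiniteMeasure μ]

/-- The function `x ↦ g (code U n x)` as an element of `L¹`. -/
def codeLp (μ : Measure α) [IsFiniteMeasure μ] (hU : ∀ i, MeasurableSet (U i)) (n : ℕ) :
    ((Fin n → Bool) → ℂ) →ₗ[ℂ] Lp ℂ 1 μ where
  toFun g := (memLp_comp_code hU g 1).toLp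
  map_add' _ _ := rfl
  map_smul' _ _ := rfl

theorem coeFn_codeLp (hU : ∀ i, MeasurableSet (U i)) {n : ℕ} (g : (Fin n → Bool) → ℂ) :
    codeLp μ hU n g =ᵐ[μ] fun x => g (code U n x) :=
  MemLp.coeFn_toLp (memLp_comp_code hU g 1)

/-- The normalized indicator function of a cell, as an element of `L¹`. -/
def cellUnit (μ : Measure α) [IsFiniteMeasure μ] (hU : ∀ i, MeasurableSet (U i)) (n : ℕ)
    (c : Fin n → Bool) : Lp ℂ 1 μ :=
  codeLp μ hU n (Pi.single c ((μ.real (cell U n c))⁻¹ : ℂ))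

theorem sum_smul_cellUnit (hU : ∀ i, MeasurableSet (U i)) {n : ℕ} (a : (Fin n → Bool) → ℂ) :
    ∑ c, a c • cellUnit μ hU n c =
      codeLp μ hU n fun c => (μ.real (cell U n c))⁻¹ • a c := by
  classical
  simp only [cellUnit, ← map_smul]
  rw [← map_sum]
  congr 1
  ext c
  rw [Finset.sum_apply, Finset.sum_eq_single c]
  · simp [mul_comm]
  · intro d _ hd
    simp [hd.symm]
  · simp

theorem coeFn_sum_smul_cellUnit (hU : ∀ i, MeasurableSet (U i)) (m : Set α → ℂ) (n : ℕ) :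
    ⇑(∑ c, m (cell U n c) • cellUnit μ hU n c) =ᵐ[μ] cellAvg μ U m n := by
  rw [sum_smul_cellUnit]
  exact coeFn_codeLp hU _

theorem tendsto_sum_integralOn_smul_cellUnit [TopologicalSpace α] [CompactSpace α] [R1Space α]
    [BorelSpace α] [μ.WeaklyRegular] [IsProbabilityMeasure μ]
    (hU : TopologicalSpace.IsTopologicalBasis (Set.range U))
    (hUm : ∀ i, MeasurableSet (U i)) (w : Lp ℂ 1 μ) :
    Tendsto (fun n => ∑ c, integralOn μ (cell U n c) w • cellUnit μ hUm n c) atTop (𝓝 w) := by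
  rw [Lp.tendsto_Lp_iff_tendsto_eLpNorm']
  refine (tendsto_eLpNorm_cellAvg_sub hU (L1.integrable_coeFn w)).congr fun n => ?_
  refine eLpNorm_congr_ae ?_
  filter_upwards [coeFn_sum_smul_cellUnit hUm (fun A => ∫ x in A, w x ∂μ) n] with x hx
  simp only [integralOn_apply, Pi.sub_apply]
  rw [← hx]

end L1Averages

/-! ### Integration of continuous functions against vector measures -/

section VectorMeasures

theorem exists_step_seq {α : Type*} [TopologicalSpace α] [CompactSpace α] {U : ℕ → Set α}
    (hU : TopologicalSpace.IsTopologicalBasis (Set.range U)) {φ : α → ℂ}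
    (hφ : Continuous φ) :
    ∃ (M : ℕ → ℕ) (g : ∀ j, (Fin (M j) → Bool) → ℂ),
      ∀ j x, ‖φ x - g j (code U (M j) x)‖ ≤ 1 / ((j : ℝ) + 1) := by
  choose M g h using fun j : ℕ =>
    exists_step_approx hU hφ (show (0 : ℝ) < 1 / ((j : ℝ) + 1) by positivity)
  exact ⟨M, g, h⟩

theorem tendsto_step_seq {α : Type*} {U : ℕ → Set α} {φ : α → ℂ} {M : ℕ → ℕ}
    {g : ∀ j, (Fin (M j) → Bool) → ℂ}
    (hg : ∀ j x, ‖φ x - g j (code U (M j) x)‖ ≤ 1 / ((j : ℝ) + 1)) (x : α) :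
    Tendsto (fun j => g j (code U (M j) x)) atTop (𝓝 (φ x)) := by
  rw [tendsto_iff_norm_sub_tendsto_zero]
  refine squeeze_zero (fun _ => norm_nonneg _) (fun j => ?_) tendsto_one_div_add_atTop_nhds_zero_nat
  rw [norm_sub_rev]
  exact hg j x

theorem exists_norm_step_seq_le {α : Type*} [TopologicalSpace α] [CompactSpace α]
    {U : ℕ → Set α} {φ : α → ℂ} (hφ : Continuous φ) {M : ℕ → ℕ}
    {g : ∀ j, (Fin (M j) → Bool) → ℂ}
    (hg : ∀ j x, ‖φ x - g j (code U (M j) x)‖ ≤ 1 / ((j : ℝ) + 1)) :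
    ∃ C : ℝ, ∀ j x, ‖g j (code U (M j) x)‖ ≤ C := by
  obtain ⟨C, hC⟩ := isCompact_univ.exists_bound_of_continuousOn hφ.continuousOn
  refine ⟨C + 1, fun j x => ?_⟩
  have h1 : ‖g j (code U (M j) x)‖ ≤ ‖φ x‖ + ‖φ x - g j (code U (M j) x)‖ := by
    rw [norm_sub_rev]
    simpa using norm_add_le (φ x) (g j (code U (M j) x) - φ x)
  have h2 : 1 / ((j : ℝ) + 1) ≤ 1 := by
    rw [div_le_one (by positivity)]
    linarith [Nat.cast_nonneg (α := ℝ) j]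
  linarith [hC x (Set.mem_univ x), hg j x]

variable {α : Type*} [MeasurableSpace α] {U : ℕ → Set α}
  {Y Y' : Type*} [NormedAddCommGroup Y] [NormedSpace ℂ Y]
  [NormedAddCommGroup Y'] [NormedSpace ℂ Y']

theorem vectorMeasure_integral_comp_code [CompleteSpace Y] (hU : ∀ i, MeasurableSet (U i))
    (F : VectorMeasure α Y) [IsFiniteMeasure F.variation] {n : ℕ} (g : (Fin n → Bool) → ℂ) :
    F.integral (fun x => g (code U n x)) (ContinuousLinearMap.lsmul ℝ ℂ) =
      ∑ c, g c • F (cell U n c) := by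
  classical
  have h : (fun x => g (code U n x)) =
      fun x => ∑ c, (cell U n c).indicator (fun _ => g c) x := by
    ext x
    simp [Set.indicator_apply, cell]
  rw [h]
  have h2 := VectorMeasure.integral_finsetSum (μ := F) (B := ContinuousLinearMap.lsmul ℝ ℂ)
    (Finset.univ : Finset (Fin n → Bool)) (f := fun c => (cell U n c).indicator (fun _ => g c))
    (fun c _ => (integrable_const (g c)).indicator (measurableSet_cell hU n c))
  refine Eq.trans h2 (Finset.sum_congr rfl fun c _ => ?_)
  rw [VectorMeasure.integral_indicator_const _ (measurableSet_cell hU n c)]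
  rfl

theorem isFiniteMeasure_variation_withDensityᵥ [CompleteSpace Y] {ρ : Measure α} {f : α → Y}
    (hf : Integrable f ρ) : IsFiniteMeasure (ρ.withDensityᵥ f).variation := by
  rw [Measure.variation_withDensityᵥ hf]
  exact ⟨by simpa using! hf.2⟩

variable [TopologicalSpace α] [CompactSpace α] [BorelSpace α]

theorem tendsto_sum_step [CompleteSpace Y]
    (hU : TopologicalSpace.IsTopologicalBasis (Set.range U))
    (F : VectorMeasure α Y) [IsFiniteMeasure F.variation] {φ : α → ℂ} (hφ : Continuous φ)
    {M : ℕ → ℕ} {g : ∀ j, (Fin (M j) → Bool) → ℂ}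
    (hg : ∀ j x, ‖φ x - g j (code U (M j) x)‖ ≤ 1 / ((j : ℝ) + 1)) :
    Tendsto (fun j => ∑ c, g j c • F (cell U (M j) c)) atTop
      (𝓝 (F.integral φ (ContinuousLinearMap.lsmul ℝ ℂ))) := by
  have hUm : ∀ i, MeasurableSet (U i) := fun i => (hU.isOpen ⟨i, rfl⟩).measurableSet
  simp only [← vectorMeasure_integral_comp_code hUm]
  obtain ⟨C, hC⟩ := exists_norm_step_seq_le hφ hg
  exact VectorMeasure.tendsto_integral_filter_of_norm_le_const
    (Eventually.of_forall fun j => (stronglyMeasurable_comp_code hUm (g j)).aestronglyMeasurable)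
    ⟨C, Eventually.of_forall fun j => Eventually.of_forall (hC j)⟩
    (Eventually.of_forall (tendsto_step_seq hg))

theorem tendsto_sum_step_setIntegral [CompleteSpace Y]
    (hU : TopologicalSpace.IsTopologicalBasis (Set.range U))
    {ρ : Measure α} {f : α → Y} (hf : Integrable f ρ) {φ : α → ℂ} (hφ : Continuous φ)
    {M : ℕ → ℕ} {g : ∀ j, (Fin (M j) → Bool) → ℂ}
    (hg : ∀ j x, ‖φ x - g j (code U (M j) x)‖ ≤ 1 / ((j : ℝ) + 1)) :
    Tendsto (fun j => ∑ c, g j c • ∫ x in cell U (M j) c, f x ∂ρ) atTop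
      (𝓝 (∫ x, φ x • f x ∂ρ)) := by
  classical
  have hUm : ∀ i, MeasurableSet (U i) := fun i => (hU.isOpen ⟨i, rfl⟩).measurableSet
  have h1 : ∀ j, ∑ c, g j c • ∫ x in cell U (M j) c, f x ∂ρ =
      ∫ x, g j (code U (M j) x) • f x ∂ρ := by
    intro j
    simp only [← integral_smul]
    simp only [← integral_indicator (measurableSet_cell hUm _ _)]
    refine (integral_finsetSum _ fun c _ =>
      (hf.smul (g j c)).indicator (measurableSet_cell hUm _ c)).symm.trans ?_
    refine integral_congr_ae (Eventually.of_forall fun x => ?_)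
    simp [Set.indicator_apply, cell]
  simp only [h1]
  obtain ⟨C, hC⟩ := exists_norm_step_seq_le hφ hg
  refine tendsto_integral_of_dominated_convergence (fun x => C * ‖f x‖) (fun j =>
    (stronglyMeasurable_comp_code hUm (g j)).aestronglyMeasurable.smul hf.aestronglyMeasurable)
    (hf.norm.const_mul C) (fun j => Eventually.of_forall fun x => ?_)
    (Eventually.of_forall fun x => (tendsto_step_seq hg x).smul_const _)
  rw [norm_smul]
  gcongr
  exact hC j x

theorem integral_withDensityᵥ [CompleteSpace Y]
    (hU : TopologicalSpace.IsTopologicalBasis (Set.range U))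
    {ρ : Measure α} {f : α → Y} (hf : Integrable f ρ) {φ : α → ℂ} (hφ : Continuous φ) :
    (ρ.withDensityᵥ f).integral φ (ContinuousLinearMap.lsmul ℝ ℂ) = ∫ x, φ x • f x ∂ρ := by
  have hUm : ∀ i, MeasurableSet (U i) := fun i => (hU.isOpen ⟨i, rfl⟩).measurableSet
  have := isFiniteMeasure_variation_withDensityᵥ hf
  obtain ⟨M, g, hg⟩ := exists_step_seq hU hφ
  refine tendsto_nhds_unique (tendsto_sum_step hU _ hφ hg) ?_
  simp only [withDensityᵥ_apply hf (measurableSet_cell hUm _ _)]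
  exact tendsto_sum_step_setIntegral hU hf hφ hg

end VectorMeasures

/-! ### Images of vector measures under bounded operators -/

section MapCLM

variable {α : Type*} [MeasurableSpace α] {U : ℕ → Set α}
  {Y Y' : Type*} [NormedAddCommGroup Y] [NormedSpace ℂ Y]
  [NormedAddCommGroup Y'] [NormedSpace ℂ Y']

/-- The image `A ↦ T (F A)` of a vector measure under a bounded operator. -/
def mapCLM (T : Y →L[ℂ] Y') (F : VectorMeasure α Y) : VectorMeasure α Y' :=
  F.mapRange T.toLinearMap.toAddMonoidHom T.continuous

@[simp]
theorem mapCLM_apply (T : Y →L[ℂ] Y') (F : VectorMeasure α Y) (A : Set α) :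
    mapCLM T F A = T (F A) := rfl

theorem variation_mapCLM_le (T : Y →L[ℂ] Y') (F : VectorMeasure α Y) :
    (mapCLM T F).variation ≤ ‖T‖₊ • F.variation := by
  refine VectorMeasure.variation_le_of_forall_enorm_le fun A _ => ?_
  rw [mapCLM_apply, Measure.smul_apply, Measure.nnreal_smul_coe_apply]
  grw [T.le_opENorm, VectorMeasure.enorm_measure_le_variation]
  rfl

instance (T : Y →L[ℂ] Y') (F : VectorMeasure α Y) [IsFiniteMeasure F.variation] :
    IsFiniteMeasure (mapCLM T F).variation :=
  isFiniteMeasure_of_le _ (variation_mapCLM_le T F)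

theorem mapCLM_withDensityᵥ [CompleteSpace Y] [CompleteSpace Y'] (T : Y →L[ℂ] Y') {ρ : Measure α}
    {f : α → Y} (hf : Integrable f ρ) :
    mapCLM T (ρ.withDensityᵥ f) = ρ.withDensityᵥ fun x => T (f x) := by
  ext A hA
  rw [mapCLM_apply, withDensityᵥ_apply hf hA, withDensityᵥ_apply (T.integrable_comp hf) hA,
    T.integral_comp_comm hf.integrableOn]

theorem mapCLM_integral [TopologicalSpace α] [CompactSpace α] [BorelSpace α]
    [CompleteSpace Y] [CompleteSpace Y']
    (hU : TopologicalSpace.IsTopologicalBasis (Set.range U)) (T : Y →L[ℂ] Y')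
    (F : VectorMeasure α Y) [IsFiniteMeasure F.variation] {φ : α → ℂ} (hφ : Continuous φ) :
    (mapCLM T F).integral φ (ContinuousLinearMap.lsmul ℝ ℂ) =
      T (F.integral φ (ContinuousLinearMap.lsmul ℝ ℂ)) := by
  obtain ⟨M, g, hg⟩ := exists_step_seq hU hφ
  refine tendsto_nhds_unique (tendsto_sum_step hU _ hφ hg) ?_
  refine ((T.continuous.tendsto _).comp (tendsto_sum_step hU F hφ hg)).congr fun j => ?_
  simp

theorem variation_absolutelyContinuous {Y : Type*} [NormedAddCommGroup Y] {μ : Measure α}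
    {F : VectorMeasure α Y}
    (h : ∀ A, MeasurableSet A → μ A = 0 → F A = 0) : F.variation ≪ μ := by
  refine Measure.AbsolutelyContinuous.mk fun A hA h0 => ?_
  rw [VectorMeasure.variation_apply_eq_zero hA]
  intro B hB hBA
  exact h B ‹_› (measure_mono_null ‹_› h0)

theorem ae_le_of_withDensity_le {μ : Measure α} [SigmaFinite μ] {f g : α → ℝ≥0∞}
    (hf : AEMeasurable f μ) (h : μ.withDensity f ≤ μ.withDensity g) : f ≤ᵐ[μ] g := by
  refine ae_le_of_forall_setLIntegral_le_of_sigmaFinite₀ hf fun s hs _ => ?_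
  rw [← withDensity_apply _ hs, ← withDensity_apply _ hs]
  exact h s

end MapCLM

/-! ### Criteria for the Radon–Nikodym properties -/

section Criteria

theorem exists_basis_seq (α : Type*) [TopologicalSpace α] [SecondCountableTopology α] [Nonempty α] :
    ∃ U : ℕ → Set α, TopologicalSpace.IsTopologicalBasis (Set.range U) := by
  obtain ⟨b, hb, -, hB⟩ := TopologicalSpace.exists_countable_basis α
  have hne : b.Nonempty := by
    obtain ⟨x⟩ := ‹Nonempty α›
    have : x ∈ ⋃₀ b := hB.sUnion_eq ▸ Set.mem_univ x
    obtain ⟨s, hs, -⟩ := this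
    exact ⟨s, hs⟩
  obtain ⟨U, rfl⟩ := hb.exists_eq_range hne
  exact ⟨U, hB⟩

theorem exists_basis_seq_of_compact (G : Type*) [Nonempty G] [TopologicalSpace G] [CompactSpace G]
    [TopologicalSpace.MetrizableSpace G] :
    ∃ U : ℕ → Set G, TopologicalSpace.IsTopologicalBasis (Set.range U) := by
  let _ := TopologicalSpace.metrizableSpaceMetric G
  exact exists_basis_seq G

theorem continuous_conj_character {G : Type*} [CommGroup G] [TopologicalSpace G]
    (γ : PontryaginDual G) :
    Continuous fun g => (starRingEnd ℂ) (γ g : ℂ) :=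
  Complex.continuous_conj.comp (continuous_subtype_val.comp (map_continuous γ))

/-- Densities pass to complemented subspaces. -/
theorem exists_density_of_complemented {α : Type*} [MeasurableSpace α] {μ : Measure α}
    {Y Y' : Type*} [NormedAddCommGroup Y] [NormedSpace ℂ Y] [CompleteSpace Y]
    [NormedAddCommGroup Y'] [NormedSpace ℂ Y'] [CompleteSpace Y'] {J : Y →L[ℂ] Y'} {P : Y' →L[ℂ] Y}
    (hPJ : ∀ y, P (J y) = y)
    {F : VectorMeasure α Y} (h : ∃ f : α → Y', Integrable f μ ∧ mapCLM J F = μ.withDensityᵥ f) :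
    ∃ f : α → Y, Integrable f μ ∧ F = μ.withDensityᵥ f := by
  obtain ⟨f, hf, h⟩ := h
  refine ⟨fun x => P (f x), P.integrable_comp hf, ?_⟩
  rw [← mapCLM_withDensityᵥ P hf, ← h]
  ext A _
  simp [hPJ]

theorem spectralMeasuresBdd_subset_AC {G : Type*} [CommGroup G] [TopologicalSpace G]
    [MeasurableSpace G] {Y : Type*} [NormedAddCommGroup Y] [NormedSpace ℂ Y]
    {Λ : Set (PontryaginDual G)}
    {μ : Measure G} :
    spectralMeasuresBdd Y μ Λ ⊆ spectralMeasuresAC Y μ Λ := by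
  rintro F ⟨hF, C, hC⟩
  refine ⟨hF, fun A _ h0 => ?_⟩
  have h1 := (VectorMeasure.enorm_measure_le_variation F A).trans (hC A)
  simpa [h0] using h1

variable {G : Type*} [CommGroup G] [TopologicalSpace G] [CompactSpace G]
  [TopologicalSpace.MetrizableSpace G] [MeasurableSpace G] [BorelSpace G]
  {Y Y' : Type*} [NormedAddCommGroup Y] [NormedSpace ℂ Y] [CompleteSpace Y]
  [NormedAddCommGroup Y'] [NormedSpace ℂ Y'] [CompleteSpace Y']
  {Λ : Set (PontryaginDual G)} {μ : Measure G}

theorem measureFourierCoeff_mapCLM (T : Y →L[ℂ] Y') (F : VectorMeasure G Y)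
    [IsFiniteMeasure F.variation] (γ : PontryaginDual G) :
    measureFourierCoeff (mapCLM T F) γ = T (measureFourierCoeff F γ) := by
  obtain ⟨U, hU⟩ := exists_basis_seq_of_compact G
  exact mapCLM_integral hU T F (continuous_conj_character γ)

theorem measureFourierCoeff_withDensityᵥ {f : G → Y} (hf : Integrable f μ) (γ : PontryaginDual G) :
    measureFourierCoeff (μ.withDensityᵥ f) γ = functionFourierCoeff μ f γ := by
  obtain ⟨U, hU⟩ := exists_basis_seq_of_compact G
  exact integral_withDensityᵥ hU hf (continuous_conj_character γ)

theorem mapCLM_mem_spectralMeasures (T : Y →L[ℂ] Y') {F : VectorMeasure G Y}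
    (hF : F ∈ spectralMeasures Y Λ) : mapCLM T F ∈ spectralMeasures Y' Λ := by
  have : IsFiniteMeasure F.variation := ⟨hF.1⟩
  refine ⟨measure_lt_top _ _, fun γ hγ => ?_⟩
  rw [measureFourierCoeff_mapCLM, hF.2 γ hγ, map_zero]

theorem mapCLM_mem_spectralMeasuresAC (T : Y →L[ℂ] Y') {F : VectorMeasure G Y}
    (hF : F ∈ spectralMeasuresAC Y μ Λ) : mapCLM T F ∈ spectralMeasuresAC Y' μ Λ :=
  ⟨mapCLM_mem_spectralMeasures T hF.1, fun A hA h0 => by rw [mapCLM_apply, hF.2 A hA h0, map_zero]⟩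

theorem mapCLM_mem_spectralMeasuresBdd (T : Y →L[ℂ] Y') {F : VectorMeasure G Y}
    (hF : F ∈ spectralMeasuresBdd Y μ Λ) : mapCLM T F ∈ spectralMeasuresBdd Y' μ Λ := by
  obtain ⟨hF, C, hC⟩ := hF
  refine ⟨mapCLM_mem_spectralMeasures T hF, ‖T‖₊ * C, ?_⟩
  grw [variation_mapCLM_le, hC, smul_smul]

theorem withDensityᵥ_mem_spectralMeasures {f : G → Y} (hf : Integrable f μ)
    (h : ∀ γ ∉ Λ, functionFourierCoeff μ f γ = 0) :
    μ.withDensityᵥ f ∈ spectralMeasures Y Λ := by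
  have := isFiniteMeasure_variation_withDensityᵥ hf
  exact ⟨measure_lt_top _ _, fun γ hγ => by rw [measureFourierCoeff_withDensityᵥ hf, h γ hγ]⟩

/-- A space has the type II property if and only if all absolutely continuous measures with
spectrum in `Λ` have Bochner integrable densities: the other requirements hold in any space. -/
theorem hasTypeIIRNP_iff : HasTypeIIRNP Y μ Λ ↔
    ∀ F ∈ spectralMeasuresAC Y μ Λ, ∃ f : G → Y, Integrable f μ ∧ F = μ.withDensityᵥ f := by
  constructor
  · intro h F hF
    obtain ⟨f, hf, -, hF⟩ := h.subset hF
    exact ⟨f, memLp_one_iff_integrable.1 hf, hF⟩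
  · intro h
    refine Set.Subset.antisymm (fun F hF => ?_) ?_
    · obtain ⟨f, hf, rfl⟩ := h F hF
      refine ⟨f, memLp_one_iff_integrable.2 hf, fun γ hγ => ?_, rfl⟩
      rw [← measureFourierCoeff_withDensityᵥ hf, hF.1.2 γ hγ]
    · rintro _ ⟨f, hf, h0, rfl⟩
      have hf := memLp_one_iff_integrable.1 hf
      refine ⟨withDensityᵥ_mem_spectralMeasures hf h0, fun A hA hA0 => ?_⟩
      rw [withDensityᵥ_apply hf hA, setIntegral_measure_zero _ hA0]

/-- A space has the type I property if and only if all measures with spectrum in `Λ` dominated by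
a multiple of `μ` have Bochner integrable densities: these are automatically bounded. -/
theorem hasTypeIRNP_iff [IsFiniteMeasure μ] : HasTypeIRNP Y μ Λ ↔
    ∀ F ∈ spectralMeasuresBdd Y μ Λ, ∃ f : G → Y, Integrable f μ ∧ F = μ.withDensityᵥ f := by
  constructor
  · intro h F hF
    obtain ⟨f, hf, -, hF⟩ := h.subset hF
    exact ⟨f, hf.integrable le_top, hF⟩
  · intro h
    refine Set.Subset.antisymm (fun F hF => ?_) ?_
    · obtain ⟨f, hf, rfl⟩ := h F hF
      obtain ⟨hs, C, hC⟩ := hF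
      rw [Measure.variation_withDensityᵥ hf] at hC
      refine ⟨f, memLp_top_of_bound hf.aestronglyMeasurable C ?_, fun γ hγ => ?_, rfl⟩
      · have h1 : (fun x => ‖f x‖ₑ) ≤ᵐ[μ] fun _ => (C : ℝ≥0∞) :=
          ae_le_of_withDensity_le hf.aestronglyMeasurable.enorm
            (by rw [withDensity_const]; exact hC)
        filter_upwards [h1] with x hx
        exact_mod_cast enorm_le_coe.1 hx
      · rw [← measureFourierCoeff_withDensityᵥ hf, hs.2 γ hγ]
    · rintro _ ⟨f, hf, h0, rfl⟩
      have hfi := hf.integrable le_top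
      refine ⟨withDensityᵥ_mem_spectralMeasures hfi h0, (eLpNorm f ∞ μ).toNNReal, ?_⟩
      rw [Measure.variation_withDensityᵥ hfi]
      refine (withDensity_mono (g := fun _ => eLpNorm f ∞ μ) ?_).trans_eq ?_
      · rw [eLpNorm_exponent_top]
        exact ae_le_eLpNormEssSup
      · rw [withDensity_const]
        conv_lhs => rw [← ENNReal.coe_toNNReal hf.2.ne]
        rfl

end Criteria

/-! ### Bounded additive set functions with values in a space with the Schur property -/

section Schur

variable {α : Type*} {U : ℕ → Set α}

theorem AdditiveOn.tendsto_real_of_disjoint {m : Set α → ℝ} (hm : AdditiveOn U m) {C : ℝ}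
    (hC : ∀ A ∈ cellAlgebra U, |m A| ≤ C) {A : ℕ → Set α} (hA : ∀ k, A k ∈ cellAlgebra U)
    (hd : Pairwise (Function.onFun Disjoint A)) : Tendsto (fun k => m (A k)) atTop (𝓝 0) := by
  have hs : Summable fun k => |m (A k)| := by
    refine summable_of_sum_le (c := C + C) (fun k => abs_nonneg _) fun s => ?_
    rw [← Finset.sum_filter_add_sum_filter_not s fun k => 0 ≤ m (A k)]
    have h1 : ∑ k ∈ s with 0 ≤ m (A k), |m (A k)| ≤ C := by
      rw [Finset.sum_congr rfl fun k hk => abs_of_nonneg (Finset.mem_filter.1 hk).2,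
        ← hm.biUnion _ hA hd]
      exact (le_abs_self _).trans (hC _ (biUnion_mem_cellAlgebra _ hA))
    have h2 : ∑ k ∈ s with ¬ 0 ≤ m (A k), |m (A k)| ≤ C := by
      rw [Finset.sum_congr rfl fun k hk => abs_of_neg (not_le.1 (Finset.mem_filter.1 hk).2),
        Finset.sum_neg_distrib, ← hm.biUnion _ hA hd]
      exact (neg_le_abs _).trans (hC _ (biUnion_mem_cellAlgebra _ hA))
    exact add_le_add h1 h2
  exact (tendsto_zero_iff_abs_tendsto_zero _).2 hs.tendsto_atTop_zero

variable {X : Type*} [NormedAddCommGroup X] [NormedSpace ℂ X] {m : Set α → X} {C : ℝ}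

/-- A bounded additive set function with values in a space with the Schur property is strongly
additive: along a disjoint sequence its values are weakly, hence norm, null. -/
theorem AdditiveOn.tendsto_of_disjoint (hX : HasSchurProperty X) (hm : AdditiveOn U m)
    (hC : ∀ A ∈ cellAlgebra U, ‖m A‖ ≤ C) {A : ℕ → Set α} (hA : ∀ k, A k ∈ cellAlgebra U)
    (hd : Pairwise (Function.onFun Disjoint A)) : Tendsto (fun k => m (A k)) atTop (𝓝 0) := by
  refine hX _ _ fun ψ => ?_
  have hb : ∀ A ∈ cellAlgebra U, ‖ψ (m A)‖ ≤ ‖ψ‖ * C := fun A hA =>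
    (ψ.le_opNorm _).trans (by gcongr; exact hC A hA)
  have h1 : Tendsto (fun k => (ψ (m (A k))).re) atTop (𝓝 0) :=
    (hm.map (Complex.reAddGroupHom.comp ψ.toLinearMap.toAddMonoidHom)).tendsto_real_of_disjoint
      (fun A hA => (Complex.abs_re_le_norm _).trans (hb A hA)) hA hd
  have h2 : Tendsto (fun k => (ψ (m (A k))).im) atTop (𝓝 0) :=
    (hm.map (Complex.imAddGroupHom.comp ψ.toLinearMap.toAddMonoidHom)).tendsto_real_of_disjoint
      (fun A hA => (Complex.abs_im_le_norm _).trans (hb A hA)) hA hd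
  rw [map_zero]
  refine squeeze_zero_norm (fun k => Complex.norm_le_abs_re_add_abs_im _) ?_
  simpa using h1.abs.add h2.abs

theorem AdditiveOn.exists_small_increments (hX : HasSchurProperty X) (hm : AdditiveOn U m)
    (hC : ∀ A ∈ cellAlgebra U, ‖m A‖ ≤ C) {D : ℕ → Set α} (hD : Monotone D) {ε : ℝ} (hε : 0 < ε) :
    ∃ L, ∀ l, ∀ E ∈ cellAlgebra U, E ⊆ D l \ D L → ‖m E‖ ≤ ε := by
  by_contra! hc
  choose l E hE hEl hEε using hc
  let L : ℕ → ℕ := fun k => Nat.rec 0 (fun _ i => max i (l i)) k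
  have hL : ∀ k, L (k + 1) = max (L k) (l (L k)) := fun _ => rfl
  have hLm : Monotone L := monotone_nat_of_le_succ fun k => (hL k).symm ▸ le_max_left _ _
  have hlt : ∀ {j k : ℕ}, j < k → Disjoint (E (L j)) (E (L k)) := by
    intro j k hjk
    have h1 : E (L j) ⊆ D (L k) := ((hEl (L j)).trans Set.sdiff_subset).trans
      (hD (((hL j).symm ▸ le_max_right _ _).trans (hLm hjk)))
    exact Set.disjoint_left.2 fun x hx hx' => (hEl (L k) hx').2 (h1 hx)
  have hd : Pairwise (Function.onFun Disjoint fun k => E (L k)) := by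
    intro j k hjk
    rcases hjk.lt_or_gt with h | h
    · exact hlt h
    · exact (hlt h).symm
  have ht := (hm.tendsto_of_disjoint hX hC (fun k => hE (L k)) hd).norm
  rw [norm_zero] at ht
  obtain ⟨k, hk⟩ := (ht.eventually (gt_mem_nhds hε)).exists
  exact absurd hk (hEε (L k)).not_gt

/-- A bounded additive set function `m` with values in a space with the Schur property is
absolutely continuous as soon as `ψ ∘ m` is for `ψ` in a set of functionals that is norming for
the values of `m`. If sets `B k` of small measure violate this, strong additivity allows to replace
them, up to small errors, by a decreasing sequence `K k` on which the values of `m` converge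
uniformly; the limit is annihilated by a norming set. -/
theorem AdditiveOn.exists_delta [MeasurableSpace α] {μ : Measure α} (hX : HasSchurProperty X)
    (hm : AdditiveOn U m) (hC : ∀ A ∈ cellAlgebra U, ‖m A‖ ≤ C) {N : Set (StrongDual ℂ X)}
    (hN1 : ∀ ψ ∈ N, ‖ψ‖ ≤ 1)
    (hN : ∀ A ∈ cellAlgebra U, ∀ r, (∀ ψ ∈ N, ‖ψ (m A)‖ ≤ r) → ‖m A‖ ≤ r)
    (hac : ∀ ψ ∈ N, ∀ ε : ℝ, 0 < ε → ∃ δ : ℝ≥0∞, 0 < δ ∧ ∀ A ∈ cellAlgebra U, μ A < δ →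
      ‖ψ (m A)‖ ≤ ε) {ε : ℝ} (hε : 0 < ε) :
    ∃ δ : ℝ≥0∞, 0 < δ ∧ ∀ A ∈ cellAlgebra U, μ A < δ → ‖m A‖ ≤ ε := by
  by_contra! hc
  have h0 : ∀ k : ℕ, ∃ B ∈ cellAlgebra U, μ B < (2⁻¹ : ℝ≥0∞) ^ k ∧ ε < ‖m B‖ :=
    fun k => hc _ (ENNReal.pow_pos (by simp) k)
  choose B hB hBμ hBε using h0
  let D : ℕ → ℕ → Set α := fun j l => ⋃ i ∈ Finset.range l, B (j + i)
  have hDm : ∀ j, Monotone (D j) := fun j l l' h =>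
    Set.biUnion_subset_biUnion_left fun i hi =>
      Finset.mem_coe.2 (Finset.range_mono h (Finset.mem_coe.1 hi))
  have hDA : ∀ j l, D j l ∈ cellAlgebra U := fun j l =>
    biUnion_mem_cellAlgebra _ fun i => hB (j + i)
  choose L hL using fun j => hm.exists_small_increments hX hC (hDm j)
    (show 0 < ε / 8 * (1 / 2) ^ j by positivity)
  let K : ℕ → Set α := fun i => ⋂ j ∈ Finset.range i, D j (L j)
  have hKA : ∀ i, K i ∈ cellAlgebra U := fun i => biInter_mem_cellAlgebra _ fun j => hDA j (L j)
  have hKsucc : ∀ i, K (i + 1) = K i ∩ D i (L i) := by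
    intro i
    simp only [K, Finset.range_add_one, Finset.set_biInter_insert]
    exact Set.inter_comm _ _
  have hKanti : Antitone K := antitone_nat_of_succ_le fun i => by
    rw [hKsucc]
    exact Set.inter_subset_left
  -- the part of `B k` outside `K (k + 1)` contributes little
  have hout : ∀ k i, i ≤ k + 1 → ‖m (B k \ K i)‖ ≤ ∑ j ∈ Finset.range i, ε / 8 * (1 / 2) ^ j := by
    intro k i
    induction i with
    | zero =>
      intro _
      simp [K, hm.empty]
    | succ i ih =>
      intro hi
      have hA1 := sdiff_mem_cellAlgebra (hB k) (hKA i)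
      have hA2 := sdiff_mem_cellAlgebra (inter_mem_cellAlgebra (hB k) (hKA i)) (hDA i (L i))
      have heq : B k \ K (i + 1) = (B k \ K i) ∪ ((B k ∩ K i) \ D i (L i)) := by
        rw [hKsucc]
        ext x
        simp only [Set.mem_sdiff, Set.mem_inter_iff, Set.mem_union]
        tauto
      have hdis : Disjoint (B k \ K i) ((B k ∩ K i) \ D i (L i)) :=
        Set.disjoint_left.2 fun x hx hx' => hx.2 hx'.1.2
      rw [heq, hm _ hA1 _ hA2 hdis, Finset.sum_range_succ]
      refine (norm_add_le _ _).trans (add_le_add (ih (by omega)) ?_)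
      refine hL i (k - i + 1) _ hA2 fun x hx => ⟨?_, hx.2⟩
      refine Set.mem_biUnion (x := k - i) (by simp) ?_
      rw [Nat.add_sub_cancel' (by omega)]
      exact hx.1.1
  have hKμ : Tendsto (fun i => μ (K i)) atTop (𝓝 0) := by
    rw [← tendsto_add_atTop_iff_nat 1]
    refine tendsto_of_tendsto_of_tendsto_of_le_of_le tendsto_const_nhds
      (ENNReal.tendsto_sum_nat_add (fun i => (2⁻¹ : ℝ≥0∞) ^ i) ?_) (fun _ => zero_le) fun i => ?_
    · simp [ENNReal.tsum_geometric]
    · calc μ (K (i + 1)) ≤ μ (D i (L i)) := measure_mono (by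
            rw [hKsucc]
            exact Set.inter_subset_right)
        _ ≤ ∑ j ∈ Finset.range (L i), μ (B (i + j)) := measure_biUnion_finset_le _ _
        _ ≤ ∑ j ∈ Finset.range (L i), (2⁻¹ : ℝ≥0∞) ^ (j + i) := by
            gcongr with j
            rw [add_comm j i]
            exact (hBμ _).le
        _ ≤ ∑' j, (2⁻¹ : ℝ≥0∞) ^ (j + i) := ENNReal.sum_le_tsum _
  obtain ⟨k, hk⟩ := hm.exists_small_increments hX hC (D := fun i => (K i)ᶜ)
    (fun i j hij => Set.compl_subset_compl.2 (hKanti hij)) (show 0 < ε / 4 by positivity)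
  have hEA := inter_mem_cellAlgebra (hB k) (hKA (k + 1))
  have hin : ‖m (B k ∩ K (k + 1))‖ ≤ ε / 4 + ε / 4 := by
    refine hN _ hEA _ fun ψ hψ => ?_
    obtain ⟨δ, hδ, hψδ⟩ := hac ψ hψ (ε / 4) (by positivity)
    obtain ⟨l, hl⟩ := (hKμ.eventually (gt_mem_nhds hδ)).exists
    rw [hm.sdiff hEA (hKA l), map_add]
    refine (norm_add_le _ _).trans (add_le_add ?_ ?_)
    · exact hψδ _ (inter_mem_cellAlgebra hEA (hKA l))
        ((measure_mono Set.inter_subset_right).trans_lt hl)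
    · refine (ψ.le_of_opNorm_le (hN1 ψ hψ) _).trans ((one_mul _).trans_le ?_)
      refine hk l _ (sdiff_mem_cellAlgebra hEA (hKA l)) fun x hx => ⟨hx.2, ?_⟩
      exact not_not.2 (hKanti (Nat.le_succ k) hx.1.2)
  have hgeo : ∑ j ∈ Finset.range (k + 1), ε / 8 * (1 / 2 : ℝ) ^ j ≤ ε / 4 := by
    rw [← Finset.mul_sum]
    have := sum_geometric_two_le (k + 1)
    nlinarith
  have htot : ‖m (B k)‖ ≤ ε / 4 + ε / 4 + ε / 4 := by
    rw [hm.sdiff (hB k) (hKA (k + 1))]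
    exact (norm_add_le _ _).trans (add_le_add hin ((hout k (k + 1) le_rfl).trans hgeo))
  linarith [hBε k]

end Schur

/-! ### Absolutely continuous scalar set functions -/

section Martingale

variable {α : Type*} [mα : MeasurableSpace α] {U : ℕ → Set α} {μ : Measure α}

/-- The filtration generated by the cells of increasing level. -/
def cellFiltration (hU : ∀ i, MeasurableSet (U i)) : Filtration ℕ mα where
  seq n := MeasurableSpace.comap (code U n) inferInstance
  mono' k n h := by
    rintro _ ⟨S, hS, rfl⟩
    exact ⟨{c | (fun i => c (Fin.castLE h i)) ∈ S}, (Set.toFinite _).measurableSet, rfl⟩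
  le' n := (measurable_code hU n).comap_le

theorem setIntegral_abs_cellAvg [IsFiniteMeasure μ] (hU : ∀ i, MeasurableSet (U i))
    {m : Set α → ℝ} (hm : AdditiveOn U m) {n : ℕ}
    (h0 : ∀ c, μ (cell U n c) = 0 → m (cell U n c) = 0) (S : Set (Fin n → Bool)) :
    ∃ S₁ S₂ : Set (Fin n → Bool), S₁ ⊆ S ∧ S₂ ⊆ S ∧
      ∫ x in code U n ⁻¹' S, |cellAvg μ U m n x| ∂μ =
        m (code U n ⁻¹' S₁) - m (code U n ⁻¹' S₂) := by
  let f : (Fin n → Bool) → ℝ := fun c => (μ.real (cell U n c))⁻¹ • m (cell U n c)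
  have hf : ∀ x, cellAvg μ U m n x = f (code U n x) := fun _ => rfl
  have hmeas : ∀ T : Set (Fin n → Bool), MeasurableSet (code U n ⁻¹' T) := fun T =>
    measurable_code hU n (Set.toFinite T).measurableSet
  have hint : Integrable (fun x => |cellAvg μ U m n x|) μ := (integrable_cellAvg hU m n).abs
  refine ⟨S ∩ {c | 0 ≤ f c}, S \ {c | 0 ≤ f c}, Set.inter_subset_left, Set.sdiff_subset, ?_⟩
  rw [← setIntegral_cellAvg hU hm h0, ← setIntegral_cellAvg hU hm h0, sub_eq_add_neg,
    ← integral_neg]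
  conv_lhs => rw [← Set.inter_union_sdiff S {c | 0 ≤ f c}, Set.preimage_union]
  rw [setIntegral_union (Disjoint.preimage _ Set.disjoint_sdiff_inter.symm) (hmeas _)
    hint.integrableOn hint.integrableOn]
  congr 1
  · exact setIntegral_congr_fun (hmeas _) fun x hx => abs_of_nonneg hx.2
  · exact setIntegral_congr_fun (hmeas _) fun x hx => abs_of_neg (not_le.1 hx.2)

/-- The averages of a bounded absolutely continuous set function over the cells form a uniformly
integrable martingale, so they converge in mean. -/
theorem exists_tendsto_cellAvg_real [IsFiniteMeasure μ] (hU : ∀ i, MeasurableSet (U i))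
    {m : Set α → ℝ} (hm : AdditiveOn U m) {C : ℝ} (hC : ∀ A ∈ cellAlgebra U, |m A| ≤ C)
    (hac : ∀ ε : ℝ, 0 < ε → ∃ δ : ℝ≥0∞, 0 < δ ∧ ∀ A ∈ cellAlgebra U, μ A < δ → |m A| ≤ ε) :
    ∃ g : α → ℝ, MemLp g 1 μ ∧
      Tendsto (fun n => eLpNorm (cellAvg μ U m n - g) 1 μ) atTop (𝓝 0) := by
  have h0 : ∀ A ∈ cellAlgebra U, μ A = 0 → m A = 0 := by
    intro A hA hA0
    refine abs_nonpos_iff.1 (le_of_forall_pos_le_add fun ε hε => ?_)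
    obtain ⟨δ, hδ, h⟩ := hac ε hε
    simpa using h A hA (hA0 ▸ hδ)
  have h0c : ∀ n c, μ (cell U n c) = 0 → m (cell U n c) = 0 := fun n c =>
    h0 _ (cell_mem_cellAlgebra n c)
  let ℱ := cellFiltration hU
  let f : ℕ → α → ℝ := fun n => cellAvg μ U m n
  have hfi : ∀ n, Integrable (f n) μ := fun n => integrable_cellAvg hU m n
  have hL1 : ∀ n, ∀ S : Set (Fin n → Bool), ∃ S₁ S₂ : Set (Fin n → Bool), S₁ ⊆ S ∧ S₂ ⊆ S ∧
      ∫⁻ x in code U n ⁻¹' S, ‖f n x‖ₑ ∂μ =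
        ENNReal.ofReal (m (code U n ⁻¹' S₁) - m (code U n ⁻¹' S₂)) := by
    intro n S
    obtain ⟨S₁, S₂, h1, h2, h3⟩ := setIntegral_abs_cellAvg hU hm (h0c n) S
    refine ⟨S₁, S₂, h1, h2, ?_⟩
    rw [← h3, ← ofReal_integral_norm_eq_lintegral_enorm (hfi n).integrableOn]
    rfl
  have hmart : Martingale f ℱ μ := by
    refine martingale_of_setIntegral_eq_succ (fun n => ?_) hfi fun n A hA => ?_
    · exact (StronglyMeasurable.of_discrete (f := fun c : Fin n → Bool =>
        (μ.real (cell U n c))⁻¹ • m (cell U n c))).comp_measurable (comap_measurable _)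
    · obtain ⟨S, -, rfl⟩ := hA
      rw [setIntegral_cellAvg hU hm (h0c n)]
      exact (setIntegral_cellAvg hU hm (h0c (n + 1))
        {c | (fun i => c (Fin.castLE (Nat.le_succ n) i)) ∈ S}).symm
  have hui : UniformIntegrable f 1 μ := by
    refine uniformIntegrable_of le_rfl (by simp) (fun n => (hfi n).aestronglyMeasurable)
      fun ε hε => ?_
    obtain ⟨δ, hδ, hmδ⟩ := hac (ε / 2) (by positivity)
    -- by Markov's inequality, the averages exceed `R` on a set of measure less than `δ` only
    obtain ⟨R, hR0, hR⟩ : ∃ R : ℝ≥0, R ≠ 0 ∧ ENNReal.ofReal (C + C) / R < δ := by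
      have ht : Tendsto (fun k : ℕ => ENNReal.ofReal (C + C) / (k : ℝ≥0∞)) atTop (𝓝 0) := by
        have := ENNReal.Tendsto.const_div (a := ENNReal.ofReal (C + C))
          ENNReal.tendsto_nat_nhds_top (Or.inr ENNReal.ofReal_ne_top)
        simpa using this
      obtain ⟨k, hk, hk0⟩ := ((ht.eventually (gt_mem_nhds hδ)).and
        (eventually_ne_atTop 0)).exists
      exact ⟨k, by exact_mod_cast hk0, by simpa using hk⟩
    refine ⟨R, fun n => ?_⟩
    let S : Set (Fin n → Bool) := {c | R ≤ ‖(μ.real (cell U n c))⁻¹ • m (cell U n c)‖₊}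
    have hS : {x | R ≤ ‖f n x‖₊} = code U n ⁻¹' S := rfl
    have hSm : MeasurableSet (code U n ⁻¹' S) :=
      measurable_code hU n (Set.toFinite S).measurableSet
    have hμS : μ (code U n ⁻¹' S) < δ := by
      refine lt_of_le_of_lt ?_ hR
      rw [ENNReal.le_div_iff_mul_le (by simp [hR0]) (by simp), mul_comm]
      obtain ⟨S₁, S₂, -, -, h3⟩ := hL1 n Set.univ
      rw [Set.preimage_univ, Measure.restrict_univ] at h3
      have h4 := mul_meas_ge_le_lintegral₀ (hfi n).aestronglyMeasurable.enorm (R : ℝ≥0∞)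
      have h5 : {x | (R : ℝ≥0∞) ≤ ‖f n x‖ₑ} = code U n ⁻¹' S := by
        rw [← hS]
        ext x
        simp [enorm_eq_nnnorm]
      rw [h5, h3] at h4
      refine h4.trans (ENNReal.ofReal_le_ofReal ?_)
      have h6 := hC _ (preimage_mem_cellAlgebra n S₁)
      have h7 := hC _ (preimage_mem_cellAlgebra n S₂)
      linarith [(abs_le.1 h6).2, (abs_le.1 h7).1]
    rw [hS, eLpNorm_indicator_eq_eLpNorm_restrict hSm, eLpNorm_one_eq_lintegral_enorm]
    obtain ⟨S₁, S₂, h1, h2, h3⟩ := hL1 n S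
    rw [h3]
    refine ENNReal.ofReal_le_ofReal ?_
    have h6 := hmδ _ (preimage_mem_cellAlgebra n S₁)
      ((measure_mono (Set.preimage_mono h1)).trans_lt hμS)
    have h7 := hmδ _ (preimage_mem_cellAlgebra n S₂)
      ((measure_mono (Set.preimage_mono h2)).trans_lt hμS)
    linarith [(abs_le.1 h6).2, (abs_le.1 h7).1]
  obtain ⟨R, hR⟩ := hui.2.2
  exact ⟨_, Filtration.memLp_limitProcess_of_eLpNorm_bdd
      (fun n => (hfi n).aestronglyMeasurable) hR,
    hmart.submartingale.tendsto_eLpNorm_one_limitProcess hui⟩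

/-- The averages of a bounded absolutely continuous complex set function over the cells converge
in `L¹`. -/
theorem exists_tendsto_cellAvg_complex [IsFiniteMeasure μ] (hU : ∀ i, MeasurableSet (U i))
    {m : Set α → ℂ} (hm : AdditiveOn U m) {C : ℝ} (hC : ∀ A ∈ cellAlgebra U, ‖m A‖ ≤ C)
    (hac : ∀ ε : ℝ, 0 < ε → ∃ δ : ℝ≥0∞, 0 < δ ∧ ∀ A ∈ cellAlgebra U, μ A < δ → ‖m A‖ ≤ ε) :
    ∃ g : α → ℂ, MemLp g 1 μ ∧
      Tendsto (fun n => eLpNorm (cellAvg μ U m n - g) 1 μ) atTop (𝓝 0) := by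
  have hm1 : AdditiveOn U fun A => (m A).re := hm.map Complex.reAddGroupHom
  have hm2 : AdditiveOn U fun A => (m A).im := hm.map Complex.imAddGroupHom
  obtain ⟨g₁, hg₁, h1⟩ := exists_tendsto_cellAvg_real (μ := μ) hU hm1 (C := C)
    (fun A hA => (Complex.abs_re_le_norm _).trans (hC A hA)) fun ε hε => by
      obtain ⟨δ, hδ, h⟩ := hac ε hε
      exact ⟨δ, hδ, fun A hA hAδ => (Complex.abs_re_le_norm _).trans (h A hA hAδ)⟩
  obtain ⟨g₂, hg₂, h2⟩ := exists_tendsto_cellAvg_real (μ := μ) hU hm2 (C := C)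
    (fun A hA => (Complex.abs_im_le_norm _).trans (hC A hA)) fun ε hε => by
      obtain ⟨δ, hδ, h⟩ := hac ε hε
      exact ⟨δ, hδ, fun A hA hAδ => (Complex.abs_im_le_norm _).trans (h A hA hAδ)⟩
  have hg : Integrable (fun x => (g₁ x : ℂ) + g₂ x * Complex.I) μ := by
    have e1 : Integrable (fun x => (g₁ x : ℂ)) μ := (memLp_one_iff_integrable.1 hg₁).ofReal
    have e2 : Integrable (fun x => (g₂ x : ℂ)) μ := (memLp_one_iff_integrable.1 hg₂).ofReal
    exact e1.add (e2.mul_const Complex.I)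
  refine ⟨fun x => (g₁ x : ℂ) + g₂ x * Complex.I, memLp_one_iff_integrable.2 hg, ?_⟩
  refine tendsto_of_tendsto_of_tendsto_of_le_of_le tendsto_const_nhds
    (by simpa using h1.add h2) (fun _ => zero_le) fun n => ?_
  have hi1 := (integrable_cellAvg (μ := μ) hU (fun A => (m A).re) n).sub
    (memLp_one_iff_integrable.1 hg₁)
  simp only [eLpNorm_one_eq_lintegral_enorm]
  rw [← lintegral_add_left' hi1.aestronglyMeasurable.enorm]
  refine lintegral_mono fun x => ?_
  have key : ∀ z : ℂ, ‖z‖ₑ ≤ ‖z.re‖ₑ + ‖z.im‖ₑ := fun z => by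
    simp only [enorm_eq_nnnorm, ← ENNReal.coe_add, ENNReal.coe_le_coe, ← NNReal.coe_le_coe,
      NNReal.coe_add, coe_nnnorm, Real.norm_eq_abs]
    exact Complex.norm_le_abs_re_add_abs_im z
  refine (key _).trans_eq ?_
  simp [cellAvg]

theorem cauchySeq_sum_smul_cellUnit [IsFiniteMeasure μ] (hU : ∀ i, MeasurableSet (U i))
    {m : Set α → ℂ} (hm : AdditiveOn U m) {C : ℝ} (hC : ∀ A ∈ cellAlgebra U, ‖m A‖ ≤ C)
    (hac : ∀ ε : ℝ, 0 < ε → ∃ δ : ℝ≥0∞, 0 < δ ∧ ∀ A ∈ cellAlgebra U, μ A < δ → ‖m A‖ ≤ ε) :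
    CauchySeq fun n => ∑ c, m (cell U n c) • cellUnit μ hU n c := by
  obtain ⟨g, hg, h⟩ := exists_tendsto_cellAvg_complex hU hm hC hac
  have ht : Tendsto (fun n => ∑ c, m (cell U n c) • cellUnit μ hU n c) atTop
      (𝓝 (hg.toLp g)) := by
    rw [Lp.tendsto_Lp_iff_tendsto_eLpNorm']
    refine h.congr fun n => eLpNorm_congr_ae ?_
    filter_upwards [coeFn_sum_smul_cellUnit hU m n, hg.coeFn_toLp] with x hx hx'
    rw [Pi.sub_apply, Pi.sub_apply, hx, hx']
  exact ht.cauchySeq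

end Martingale

/-! ### Weak limits of bounded sequences of functions -/

section WeakLimits

variable {α : Type*} [TopologicalSpace α] [CompactSpace α] [T2Space α] [MeasurableSpace α]
  [BorelSpace α] {μ : Measure α}

/-- Along an ultrafilter, a sequence of nonnegative functions that is bounded in `L¹` converges
weakly to a finite measure. -/
theorem exists_finiteMeasure_of_lintegral_le {f : ℕ → α → ℝ} (hf : ∀ n, Integrable (f n) μ)
    (h0 : ∀ n x, 0 ≤ f n x) {C : ℝ≥0} (hC : ∀ n, ∫⁻ x, ‖f n x‖ₑ ∂μ ≤ C) :
    ∃ ν : FiniteMeasure α, ∀ φ : α → ℂ, Continuous φ →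
      Tendsto (fun n => ∫ x, φ x * f n x ∂μ) (hyperfilter ℕ : Filter ℕ)
        (𝓝 (∫ x, φ x ∂(ν : Measure α))) := by
  have e : ∀ n, ∫⁻ x, ‖f n x‖ₑ ∂μ = ∫⁻ x, ((f n x).toNNReal : ℝ≥0∞) ∂μ := fun n =>
    lintegral_congr fun x => by rw [Real.enorm_of_nonneg (h0 n x)]; rfl
  have hfin : ∀ n, IsFiniteMeasure (μ.withDensity fun x => ((f n x).toNNReal : ℝ≥0∞)) := fun n =>
    isFiniteMeasure_withDensity (by rw [← e]; exact ((hC n).trans_lt (by simp)).ne)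
  let ν : ℕ → FiniteMeasure α := fun n => ⟨μ.withDensity fun x => ((f n x).toNNReal : ℝ≥0∞), hfin n⟩
  have hν : ∀ n, ν n ∈ {ρ : FiniteMeasure α | ρ.mass ≤ C} := fun n => by
    rw [Set.mem_ofPred_eq, ← ENNReal.coe_le_coe, FiniteMeasure.ennreal_mass]
    change (μ.withDensity fun x => ((f n x).toNNReal : ℝ≥0∞)) Set.univ ≤ C
    rw [withDensity_apply _ MeasurableSet.univ, Measure.restrict_univ, ← e]
    exact hC n
  obtain ⟨ρ, -, hρ⟩ := isCompact_iff_ultrafilter_le_nhds.1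
    (isCompact_setOfPred_finiteMeasure_le_of_compactSpace α C) ((hyperfilter ℕ).map ν)
    (by rw [Ultrafilter.coe_map, le_principal_iff, Filter.mem_map]
        exact Filter.univ_mem' hν)
  have hρ' : Tendsto ν (hyperfilter ℕ : Filter ℕ) (𝓝 ρ) := hρ
  refine ⟨ρ, fun φ hφ => ?_⟩
  have h1 := (FiniteMeasure.tendsto_iff_forall_integral_rclike_tendsto ℂ).1 hρ'
    (BoundedContinuousFunction.mkOfCompact ⟨φ, hφ⟩)
  refine h1.congr fun n => ?_
  change ∫ x, φ x ∂(μ.withDensity fun x => ((f n x).toNNReal : ℝ≥0∞)) = _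
  rw [integral_withDensity_eq_integral_smul₀ (hf n).aestronglyMeasurable.aemeasurable.real_toNNReal]
  refine integral_congr_ae (Eventually.of_forall fun x => ?_)
  simp [NNReal.smul_def, h0 n x, mul_comm]

/-- A sequence of complex functions that is bounded in `L¹` has a weak cluster point among the
complex measures, written here in polar form. -/
theorem exists_complexMeasure_of_lintegral_le {κ : ℕ → α → ℂ} (hκ : ∀ n, Integrable (κ n) μ)
    {C : ℝ≥0} (hC : ∀ n, ∫⁻ x, ‖κ n x‖ₑ ∂μ ≤ C) :
    ∃ (ρ : Measure α) (θ : α → ℂ), IsFiniteMeasure ρ ∧ Integrable θ ρ ∧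
      ∀ φ : α → ℂ, Continuous φ → ∀ L, Tendsto (fun n => ∫ x, φ x * κ n x ∂μ) atTop (𝓝 L) →
        L = ∫ x, φ x * θ x ∂ρ := by
  -- `z = ∑ i, u i * T i z` decomposes a complex number into four nonnegative parts
  let u : Fin 4 → ℂ := ![1, -1, Complex.I, -Complex.I]
  let T : Fin 4 → ℂ → ℝ := ![fun z => max z.re 0, fun z => max (-z.re) 0, fun z => max z.im 0,
    fun z => max (-z.im) 0]
  have hT : ∀ i, Continuous (T i) := by
    intro i
    fin_cases i <;> simp only [T] <;> simp <;> fun_prop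
  have hT0 : ∀ i z, 0 ≤ T i z := by
    intro i z
    fin_cases i <;> simp [T]
  have hT1 : ∀ i z, T i z ≤ ‖z‖ := by
    intro i z
    have h1 := abs_le.1 (Complex.abs_re_le_norm z)
    have h2 := abs_le.1 (Complex.abs_im_le_norm z)
    fin_cases i <;> simp [T] <;> linarith
  have hu : ∀ z : ℂ, z = ∑ i, u i * T i z := by
    intro z
    have hmax : ∀ a : ℝ, max a 0 - max (-a) 0 = a := fun a => by
      rcases le_total 0 a with h | h <;> simp [h]
    simp only [Fin.sum_univ_four, u, T]
    apply Complex.ext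
    · have := hmax z.re
      simp
      linarith
    · have := hmax z.im
      simp
      linarith
  have hi : ∀ i n, Integrable (fun x => T i (κ n x)) μ := fun i n =>
    (hκ n).norm.mono' ((hT i).comp_aestronglyMeasurable (hκ n).aestronglyMeasurable)
      (Eventually.of_forall fun x => by
        rw [Real.norm_of_nonneg (hT0 _ _)]
        exact hT1 i _)
  choose ν hν using fun i => exists_finiteMeasure_of_lintegral_le (hi i) (fun n x => hT0 i _)
    (C := C) (fun n => (lintegral_mono fun x => by
      rw [enorm_le_iff_norm_le, Real.norm_of_nonneg (hT0 _ _)]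
      exact hT1 i _).trans (hC n))
  let ρ : Measure α := ∑ i, (ν i : Measure α)
  have hac : ∀ i, (ν i : Measure α) ≪ ρ := fun i =>
    Measure.absolutelyContinuous_of_le (Finset.single_le_sum (f := fun i => (ν i : Measure α))
      (fun _ _ => Measure.zero_le _) (Finset.mem_univ i))
  let r : Fin 4 → α → ℂ := fun i x => (((ν i : Measure α).rnDeriv ρ x).toReal : ℂ)
  have hr : ∀ i, Integrable (r i) ρ := fun i => Measure.integrable_toReal_rnDeriv.ofReal
  refine ⟨ρ, fun x => ∑ i, u i * r i x, inferInstance,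
    integrable_finsetSum _ fun i _ => (hr i).const_mul _, fun φ hφ L hL => ?_⟩
  refine tendsto_nhds_unique (hL.mono_left Nat.hyperfilter_le_atTop) ?_
  obtain ⟨K, hK⟩ := isCompact_univ.exists_bound_of_continuousOn hφ.continuousOn
  have hbd : ∀ (σ : Measure α) (g : α → ℂ), Integrable g σ → Integrable (fun x => φ x * g x) σ :=
    fun σ g hg => hg.bdd_mul hφ.aestronglyMeasurable
      (Eventually.of_forall fun x => hK x (Set.mem_univ x))
  have h1 : ∀ n, ∫ x, φ x * κ n x ∂μ = ∑ i, u i * ∫ x, φ x * T i (κ n x) ∂μ := fun n => by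
    simp only [← integral_const_mul]
    refine Eq.trans ?_
      (integral_finsetSum _ fun i _ => (hbd _ _ (hi i n).ofReal).const_mul (u i))
    refine integral_congr_ae (Eventually.of_forall fun x => ?_)
    simp only
    conv_lhs => rw [hu (κ n x), Finset.mul_sum]
    exact Finset.sum_congr rfl fun i _ => by ring
  have h2 : ∫ x, φ x * ∑ i, u i * r i x ∂ρ = ∑ i, u i * ∫ x, φ x ∂(ν i : Measure α) := by
    have h3 : ∀ i, ∫ x, φ x ∂(ν i : Measure α) = ∫ x, φ x * r i x ∂ρ := fun i => by
      rw [← integral_rnDeriv_smul (hac i)]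
      refine integral_congr_ae (Eventually.of_forall fun x => ?_)
      simp [r, mul_comm]
    simp only [h3, ← integral_const_mul]
    refine Eq.trans ?_ (integral_finsetSum _ fun i _ => (hbd _ _ (hr i)).const_mul (u i))
    refine integral_congr_ae (Eventually.of_forall fun x => ?_)
    simp only [Finset.mul_sum]
    exact Finset.sum_congr rfl fun i _ => by ring
  simp only [h1, h2]
  exact tendsto_finsetSum _ fun i _ => (hν i φ hφ).const_mul _

/-- Indicator functions are limits almost everywhere of bounded continuous functions. -/
theorem exists_continuous_tendsto_indicator [IsFiniteMeasure μ] [μ.WeaklyRegular] {A : Set α}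
    (hA : MeasurableSet A) :
    ∃ φ : ℕ → α → ℂ, (∀ k, Continuous (φ k)) ∧ (∀ k x, ‖φ k x‖ ≤ 1) ∧
      ∀ᵐ x ∂μ, Tendsto (fun k => φ k x) atTop (𝓝 (A.indicator (fun _ => 1) x)) := by
  let a : α → ℝ := A.indicator fun _ => 1
  have ha : MemLp a 1 μ := memLp_one_iff_integrable.2 ((integrable_const 1).indicator hA)
  choose v hv hvL using fun k : ℕ => ha.exists_boundedContinuous_eLpNorm_sub_le (by simp)
    (ε := ((k : ℝ≥0∞) + 1)⁻¹) (by simp)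
  have hm : TendstoInMeasure μ (fun k => ⇑(v k)) atTop a := by
    refine tendstoInMeasure_of_tendsto_eLpNorm one_ne_zero
      (fun k => (hvL k).aestronglyMeasurable) ha.aestronglyMeasurable ?_
    refine tendsto_of_tendsto_of_tendsto_of_le_of_le tendsto_const_nhds
      ((ENNReal.tendsto_inv_nat_nhds_zero).comp (tendsto_add_atTop_nat 1)) (fun _ => zero_le)
      fun k => ?_
    rw [eLpNorm_sub_comm]
    simpa using hv k
  obtain ⟨ns, -, hns⟩ := hm.exists_seq_tendsto_ae
  refine ⟨fun k x => ((max 0 (min 1 (v (ns k) x)) : ℝ) : ℂ), fun k => ?_, fun k x => ?_, ?_⟩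
  · have := (v (ns k)).continuous
    fun_prop
  · rw [Complex.norm_real, Real.norm_of_nonneg (le_max_left _ _)]
    simp
  · filter_upwards [hns] with x hx
    have hc : Continuous fun y : ℝ => ((max 0 (min 1 y) : ℝ) : ℂ) := by fun_prop
    have h := (hc.tendsto (a x)).comp hx
    convert! h using 2
    by_cases hxA : x ∈ A <;> simp [a, hxA]

end WeakLimits

/-! ### Measures with values in `L¹` and spectrum in a Riesz set -/

section RieszSets

theorem countable_pontryaginDual (G : Type*) [CommGroup G] [TopologicalSpace G]
    [IsTopologicalGroup G] [CompactSpace G] [TopologicalSpace.MetrizableSpace G] :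
    Countable (PontryaginDual G) := by
  let _ := TopologicalSpace.metrizableSpaceMetric G
  have h : Topology.IsInducing
      (ContinuousMonoidHom.toContinuousMap : (G →ₜ* Circle) → C(G, Circle)) :=
    ContinuousMonoidHom.isInducing_toContinuousMap G Circle
  have : SecondCountableTopology (PontryaginDual G) := h.secondCountableTopology
  exact TopologicalSpace.separableSpace_iff_countable.1 inferInstance

/-- If the Fourier coefficients of a bounded sequence in `L¹` tend to `0` off a Riesz set, then its
weak cluster points are functions. -/
theorem IsRieszSet.exists_integrable {G : Type*} [CommGroup G] [TopologicalSpace G]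
    [CompactSpace G] [TopologicalSpace.MetrizableSpace G] [MeasurableSpace G] [BorelSpace G]
    {μ : Measure G} {Λ : Set (PontryaginDual G)} (hΛ : IsRieszSet μ Λ) {κ : ℕ → G → ℂ}
    (hκ : ∀ n, Integrable (κ n) μ) {C : ℝ≥0} (hC : ∀ n, ∫⁻ x, ‖κ n x‖ₑ ∂μ ≤ C)
    (h : ∀ γ ∉ Λ, Tendsto (fun n => ∫ x, (starRingEnd ℂ) (γ x : ℂ) * κ n x ∂μ) atTop (𝓝 0)) :
    ∃ w : G → ℂ, Integrable w μ ∧ ∀ φ : G → ℂ, Continuous φ → ∀ L,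
      Tendsto (fun n => ∫ x, φ x * κ n x ∂μ) atTop (𝓝 L) → L = ∫ x, φ x * w x ∂μ := by
  obtain ⟨ρ, θ, hρ, hθ, hlim⟩ := exists_complexMeasure_of_lintegral_le hκ hC
  have hmem : ρ.withDensityᵥ θ ∈ spectralMeasures ℂ Λ :=
    withDensityᵥ_mem_spectralMeasures hθ fun γ hγ =>
      (hlim _ (continuous_conj_character γ) 0 (h γ hγ)).symm
  obtain ⟨w, hw, -, hwθ⟩ := hΛ.subset hmem
  have hw := memLp_one_iff_integrable.1 hw
  obtain ⟨U, hU⟩ := exists_basis_seq_of_compact G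
  refine ⟨w, hw, fun φ hφ L hL => ?_⟩
  have h1 := integral_withDensityᵥ hU hθ hφ
  rw [hwθ, integral_withDensityᵥ hU hw hφ] at h1
  exact (hlim φ hφ L hL).trans h1.symm

section Averages

variable {α : Type*} [MeasurableSpace α] {U : ℕ → Set α} {μ : Measure α} [IsFiniteMeasure μ]

theorem integral_comp_code_mul_cellAvg (hU : ∀ i, MeasurableSet (U i)) {m : Set α → ℂ}
    (hm : AdditiveOn U m) {k n : ℕ} (hkn : k ≤ n)
    (h0 : ∀ c, μ (cell U n c) = 0 → m (cell U n c) = 0) (g : (Fin k → Bool) → ℂ) :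
    ∫ x, g (code U k x) * cellAvg μ U m n x ∂μ = ∑ c, g c * m (cell U k c) := by
  have h1 := integral_comp_code (μ := μ) hU (n := n) fun d =>
    g (fun i => d (Fin.castLE hkn i)) * ((μ.real (cell U n d))⁻¹ • m (cell U n d))
  refine h1.trans ?_
  simp only [hm.cell_eq_sum hkn]
  rw [← Finset.sum_fiberwise Finset.univ fun d : Fin n → Bool => fun i => d (Fin.castLE hkn i)]
  refine Finset.sum_congr rfl fun c _ => ?_
  rw [Finset.mul_sum]
  refine Finset.sum_congr rfl fun d hd => ?_
  rw [(Finset.mem_filter.1 hd).2]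
  by_cases hc : μ (cell U n d) = 0
  · simp [h0 d hc]
  · rw [← smul_eq_mul (g c) (m _), mul_smul_comm, smul_inv_smul₀, smul_eq_mul]
    rwa [Ne, measureReal_eq_zero_iff]

/-- The averages of a set function of bounded variation converge weakly as soon as a subsequence
of the integrals of the approximating step functions does. -/
theorem tendsto_integral_mul_cellAvg (hU : ∀ i, MeasurableSet (U i)) {m : Set α → ℂ}
    (hm : AdditiveOn U m) (h0 : ∀ n c, μ (cell U n c) = 0 → m (cell U n c) = 0) {C : ℝ≥0}
    (hC : ∀ n, ∑ c, ‖m (cell U n c)‖ₑ ≤ C) {φ : α → ℂ} (hφ : AEStronglyMeasurable φ μ)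
    {M : ℕ → ℕ} {g : ∀ j, (Fin (M j) → Bool) → ℂ}
    (hg : ∀ j x, ‖φ x - g j (code U (M j) x)‖ ≤ 1 / ((j : ℝ) + 1)) {ns : ℕ → ℕ}
    (hns : Tendsto ns atTop atTop) {L : ℂ}
    (hL : Tendsto (fun j => ∑ c, g (ns j) c * m (cell U (M (ns j)) c)) atTop (𝓝 L)) :
    Tendsto (fun n => ∫ x, φ x * cellAvg μ U m n x ∂μ) atTop (𝓝 L) := by
  have hbd : ∀ j n, M j ≤ n → ‖∫ x, φ x * cellAvg μ U m n x ∂μ - ∑ c, g j c * m (cell U (M j) c)‖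
      ≤ 1 / ((j : ℝ) + 1) * C := by
    intro j n hn
    have hi : Integrable (cellAvg μ U m n) μ := integrable_cellAvg hU m n
    have hgi : Integrable (fun x => g j (code U (M j) x) * cellAvg μ U m n x) μ := by
      refine hi.bdd_mul (c := ∑ c, ‖g j c‖)
        (stronglyMeasurable_comp_code hU (g j)).aestronglyMeasurable
        (Eventually.of_forall fun x => Finset.single_le_sum (f := fun c => ‖g j c‖)
          (fun c _ => norm_nonneg _) (Finset.mem_univ _))
    have hdi : Integrable (fun x => (φ x - g j (code U (M j) x)) * cellAvg μ U m n x) μ :=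
      hi.bdd_mul (hφ.sub (stronglyMeasurable_comp_code hU (g j)).aestronglyMeasurable)
        (Eventually.of_forall (hg j))
    have h1 : ∫ x, φ x * cellAvg μ U m n x ∂μ =
        ∫ x, (φ x - g j (code U (M j) x)) * cellAvg μ U m n x ∂μ +
        ∫ x, g j (code U (M j) x) * cellAvg μ U m n x ∂μ := by
      rw [← integral_add hdi hgi]
      congr 1
      ext x
      ring
    rw [← integral_comp_code_mul_cellAvg hU hm hn (h0 n) (g j), h1, add_sub_cancel_right]
    have h2 : ∫ x, ‖cellAvg μ U m n x‖ ∂μ ≤ C := by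
      rw [integral_norm_eq_lintegral_enorm hi.aestronglyMeasurable]
      exact ENNReal.toReal_le_coe_of_le_coe ((lintegral_enorm_cellAvg_le hU m n).trans (hC n))
    calc _ ≤ ∫ x, 1 / ((j : ℝ) + 1) * ‖cellAvg μ U m n x‖ ∂μ := by
          refine norm_integral_le_of_norm_le (hi.norm.const_mul _)
            (Eventually.of_forall fun x => ?_)
          rw [norm_mul]
          gcongr
          exact hg j x
      _ = 1 / ((j : ℝ) + 1) * ∫ x, ‖cellAvg μ U m n x‖ ∂μ := integral_const_mul _ _
      _ ≤ _ := by gcongr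
  rw [Metric.tendsto_atTop]
  intro ε hε
  have ht : Tendsto (fun j => 1 / ((ns j : ℝ) + 1) * C) atTop (𝓝 0) := by
    simpa using ((tendsto_one_div_add_atTop_nhds_zero_nat (𝕜 := ℝ)).comp hns).mul_const (C : ℝ)
  obtain ⟨j, hj1, hj2⟩ := ((ht.eventually (gt_mem_nhds (half_pos hε))).and
    (hL.eventually (Metric.ball_mem_nhds L (half_pos hε)))).exists
  refine ⟨M (ns j), fun n hn => ?_⟩
  have h1 := hbd (ns j) n hn
  rw [← dist_eq_norm] at h1
  linarith [dist_triangle (∫ x, φ x * cellAvg μ U m n x ∂μ)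
    (∑ c, g (ns j) c * m (cell U (M (ns j)) c)) L, Metric.mem_ball.1 hj2]

end Averages

end RieszSets

/-! ### Pointwise values of measures with values in `L¹` -/

section PointwiseValues

variable {α : Type*} [MeasurableSpace α] {U : ℕ → Set α} {μ : Measure α}
  {β : Type*} [MeasurableSpace β] {σ : Measure β} {ν : VectorMeasure α (Lp ℂ 1 σ)}

theorem ae_additiveOn (hU : ∀ i, MeasurableSet (U i)) (ν : VectorMeasure α (Lp ℂ 1 σ)) :
    ∀ᵐ t ∂σ, AdditiveOn U fun A => ν A t := by
  have h : ∀ᵐ t ∂σ, ∀ A ∈ cellAlgebra U, ∀ B ∈ cellAlgebra U, Disjoint A B →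
      ν (A ∪ B) t = ν A t + ν B t := by
    refine (ae_ball_iff countable_cellAlgebra).2 fun A hA =>
      (ae_ball_iff countable_cellAlgebra).2 fun B hB => ?_
    by_cases hd : Disjoint A B
    · rw [VectorMeasure.of_union hd (measurableSet_of_mem_cellAlgebra hU hA)
        (measurableSet_of_mem_cellAlgebra hU hB)]
      filter_upwards [Lp.coeFn_add (ν A) (ν B)] with t ht _
      rw [ht, Pi.add_apply]
    · exact Eventually.of_forall fun t h => absurd h hd
  exact h

theorem ae_apply_eq_zero (hU : ∀ i, MeasurableSet (U i))
    (h : ∀ A, MeasurableSet A → μ A = 0 → ν A = 0) :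
    ∀ᵐ t ∂σ, ∀ A ∈ cellAlgebra U, μ A = 0 → ν A t = 0 := by
  refine (ae_ball_iff countable_cellAlgebra).2 fun A hA => ?_
  by_cases h0 : μ A = 0
  · rw [h A (measurableSet_of_mem_cellAlgebra hU hA) h0]
    filter_upwards [Lp.coeFn_zero ℂ 1 σ] with t ht _
    rw [ht, Pi.zero_apply]
  · exact Eventually.of_forall fun t h => absurd h h0

theorem sum_enorm_cell_le_variation {Y : Type*} [NormedAddCommGroup Y]
    (hU : ∀ i, MeasurableSet (U i)) (F : VectorMeasure α Y) (n : ℕ) :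
    ∑ c, ‖F (cell U n c)‖ₑ ≤ F.variation Set.univ := by
  calc ∑ c, ‖F (cell U n c)‖ₑ ≤ ∑ c, F.variation (cell U n c) := by
        gcongr
        exact VectorMeasure.enorm_measure_le_variation _ _
    _ = F.variation (⋃ c ∈ (Finset.univ : Finset (Fin n → Bool)), cell U n c) := by
        rw [measure_biUnion_finset]
        · exact fun c _ d _ hcd => Disjoint.preimage _ (by simpa using hcd)
        · exact fun c _ => measurableSet_cell hU n c
    _ ≤ F.variation Set.univ := measure_mono (Set.subset_univ _)

/-- The pointwise total variation of a measure with values in `L¹`, computed along the cells. -/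
def cellVariation (U : ℕ → Set α) (ν : VectorMeasure α (Lp ℂ 1 σ)) (t : β) : ℝ≥0∞ :=
  ⨆ n, ∑ c, ‖ν (cell U n c) t‖ₑ

theorem measurable_cellVariation : Measurable (cellVariation U ν) :=
  Measurable.iSup fun _ => Finset.measurable_fun_sum _ fun _ _ =>
    (Lp.stronglyMeasurable _).measurable.enorm

theorem lintegral_cellVariation_le (hU : ∀ i, MeasurableSet (U i)) :
    ∫⁻ t, cellVariation U ν t ∂σ ≤ ν.variation Set.univ := by
  unfold cellVariation
  rw [lintegral_iSup' (fun n => (Finset.measurable_fun_sum _ fun c _ =>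
    (Lp.stronglyMeasurable _).measurable.enorm).aemeasurable)]
  · refine iSup_le fun n => ?_
    rw [lintegral_finsetSum _ fun c _ => (Lp.stronglyMeasurable _).measurable.enorm]
    refine le_trans (Finset.sum_le_sum fun c _ => ?_) (sum_enorm_cell_le_variation hU ν n)
    rw [← eLpNorm_one_eq_lintegral_enorm, Lp.enorm_def]
  · filter_upwards [ae_additiveOn hU ν] with t ht
    exact ht.sum_enorm_mono

theorem ae_cellVariation_lt_top [IsFiniteMeasure ν.variation] (hU : ∀ i, MeasurableSet (U i)) :
    ∀ᵐ t ∂σ, cellVariation U ν t < ∞ :=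
  ae_lt_top measurable_cellVariation
    ((lintegral_cellVariation_le hU).trans_lt (measure_lt_top _ _)).ne

theorem lintegral_enorm_cellAvg_le_cellVariation [IsFiniteMeasure μ]
    (hU : ∀ i, MeasurableSet (U i)) (n : ℕ) (t : β) :
    ∫⁻ x, ‖cellAvg μ U (fun A => ν A t) n x‖ₑ ∂μ ≤ cellVariation U ν t :=
  (lintegral_enorm_cellAvg_le hU _ n).trans
    (le_iSup (fun n => ∑ c, ‖ν (cell U n c) t‖ₑ) n)

theorem coeFn_sum_smul {ι : Type*} (s : Finset ι) (a : ι → ℂ) (w : ι → Lp ℂ 1 σ) :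
    ⇑(∑ i ∈ s, a i • w i) =ᵐ[σ] fun t => ∑ i ∈ s, a i * w i t := by
  classical
  induction s using Finset.induction_on with
  | empty =>
    simp only [Finset.sum_empty]
    exact Lp.coeFn_zero ℂ 1 σ
  | insert i s hi ih =>
    simp only [Finset.sum_insert hi]
    filter_upwards [Lp.coeFn_add (a i • w i) (∑ i ∈ s, a i • w i), Lp.coeFn_smul (a i) (w i), ih]
      with t h1 h2 h3
    rw [h1, Pi.add_apply, h2, h3, Pi.smul_apply, smul_eq_mul]

/-- For almost every `t`, the averages of `A ↦ ν A t` converge weakly, and the limits are given by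
the integrals with respect to `ν`. -/
theorem ae_tendsto_integral_mul_cellAvg [TopologicalSpace α] [CompactSpace α] [BorelSpace α]
    [IsFiniteMeasure μ] (hU : TopologicalSpace.IsTopologicalBasis (Set.range U))
    (hUm : ∀ i, MeasurableSet (U i)) [IsFiniteMeasure ν.variation]
    (h : ∀ A, MeasurableSet A → μ A = 0 → ν A = 0) {φ : α → ℂ} (hφ : Continuous φ) :
    ∀ᵐ t ∂σ, Tendsto (fun n => ∫ x, φ x * cellAvg μ U (fun A => ν A t) n x ∂μ) atTop
      (𝓝 ((ν.integral φ (ContinuousLinearMap.lsmul ℝ ℂ) : Lp ℂ 1 σ) t)) := by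
  have := hU.secondCountableTopology (Set.countable_range U)
  obtain ⟨M, g, hg⟩ := exists_step_seq hU hφ
  obtain ⟨ns, hns, hlim⟩ :=
    (tendstoInMeasure_of_tendsto_Lp (tendsto_sum_step hU ν hφ hg)).exists_seq_tendsto_ae
  have hsum := ae_all_iff.2 fun j : ℕ =>
    coeFn_sum_smul Finset.univ (g j) fun c => ν (cell U (M j) c)
  filter_upwards [ae_additiveOn hUm ν, ae_apply_eq_zero hUm h, ae_cellVariation_lt_top (ν := ν) hUm,
    hlim, hsum] with t hadd h0 hV ht hs
  refine tendsto_integral_mul_cellAvg hUm hadd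
    (fun n c hc => h0 _ (cell_mem_cellAlgebra n c) hc) (C := (cellVariation U ν t).toNNReal)
    (fun n => ?_) hφ.aestronglyMeasurable hg hns.tendsto_atTop ?_
  · rw [ENNReal.coe_toNNReal hV.ne]
    exact le_iSup (fun n => ∑ c, ‖ν (cell U n c) t‖ₑ) n
  · exact ht.congr fun j => hs (ns j)

/-- If, for almost every `t`, the integrals of continuous functions are represented by an
integrable function, then so are the values on measurable sets. -/
theorem ae_apply_eq_setIntegral [TopologicalSpace α] [CompactSpace α] [T2Space α] [BorelSpace α]
    [IsFiniteMeasure μ] [μ.WeaklyRegular] [IsFiniteMeasure ν.variation]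
    (h : ∀ A, MeasurableSet A → μ A = 0 → ν A = 0) {w : β → α → ℂ}
    (hw : ∀ φ : α → ℂ, Continuous φ → ∀ᵐ t ∂σ, Integrable (w t) μ ∧
      (ν.integral φ (ContinuousLinearMap.lsmul ℝ ℂ) : Lp ℂ 1 σ) t = ∫ x, φ x * w t x ∂μ)
    {A : Set α} (hA : MeasurableSet A) : ∀ᵐ t ∂σ, ν A t = ∫ x in A, w t x ∂μ := by
  obtain ⟨φ, hφ, hφ1, hφA⟩ := exists_continuous_tendsto_indicator (μ := μ) hA
  have hν : ν.variation ≪ μ := variation_absolutelyContinuous h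
  have h1 : Tendsto (fun k => ν.integral (φ k) (ContinuousLinearMap.lsmul ℝ ℂ)) atTop
      (𝓝 (ν A)) := by
    have h2 : Tendsto (fun k => ν.integral (φ k) (ContinuousLinearMap.lsmul ℝ ℂ)) atTop
        (𝓝 (ν.integral (A.indicator fun _ => 1) (ContinuousLinearMap.lsmul ℝ ℂ))) :=
      VectorMeasure.tendsto_integral_filter_of_norm_le_const
        (Eventually.of_forall fun k => (hφ k).aestronglyMeasurable)
        ⟨1, Eventually.of_forall fun k => Eventually.of_forall (hφ1 k)⟩ (hν.ae_le hφA)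
    rw [VectorMeasure.integral_indicator_const _ hA] at h2
    simpa using h2
  obtain ⟨ns, hns, hlim⟩ := (tendstoInMeasure_of_tendsto_Lp h1).exists_seq_tendsto_ae
  filter_upwards [hlim, ae_all_iff.2 fun k => hw (φ k) (hφ k)] with t ht hk
  refine tendsto_nhds_unique ht ?_
  simp only [(hk _).2]
  have hwi := (hk 0).1
  rw [← integral_indicator hA]
  refine tendsto_integral_of_dominated_convergence (fun x => ‖w t x‖)
    (fun k => (hφ _).aestronglyMeasurable.mul hwi.aestronglyMeasurable) hwi.norm
    (fun k => Eventually.of_forall fun x => ?_) ?_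
  · rw [norm_mul]
    exact mul_le_of_le_one_left (norm_nonneg _) (hφ1 _ x)
  · filter_upwards [hφA] with x hx
    have h3 := (hx.comp hns.tendsto_atTop).mul_const (w t x)
    convert! h3 using 2
    by_cases hxA : x ∈ A <;> simp [hxA]

end PointwiseValues

/-! ### Densities of measures with values in `L¹` -/

section RieszDensity

variable {α : Type*} [MeasurableSpace α] {U : ℕ → Set α} {μ : Measure α}
  {β : Type*} [MeasurableSpace β] {σ : Measure β} {ν : VectorMeasure α (Lp ℂ 1 σ)}

theorem measurable_cellAvg_apply (hU : ∀ i, MeasurableSet (U i)) (n : ℕ) :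
    Measurable fun p : α × β => cellAvg μ U (fun A => ν A p.2) n p.1 := by
  let f : (Fin n → Bool) × β → ℂ := fun q => (μ.real (cell U n q.1))⁻¹ • ν (cell U n q.1) q.2
  have h : Measurable f := by
    refine measurable_from_prod_countable_right fun c => ?_
    have hc : Measurable (ν (cell U n c)) := (Lp.stronglyMeasurable (ν (cell U n c))).measurable
    exact hc.const_smul (μ.real (cell U n c))⁻¹
  have e : (fun p : α × β => cellAvg μ U (fun A => ν A p.2) n p.1) =
      f ∘ Prod.map (code U n) id := rfl
  rw [e]
  exact h.comp ((measurable_code hU n).prodMap measurable_id)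

theorem enorm_cellAvg_sub (n k : ℕ) (x : α) :
    ‖cellAvg μ U (fun A => ν A) n x - cellAvg μ U (fun A => ν A) k x‖ₑ =
      ∫⁻ t, ‖cellAvg μ U (fun A => ν A t) n x - cellAvg μ U (fun A => ν A t) k x‖ₑ ∂σ := by
  rw [Lp.enorm_def, eLpNorm_one_eq_lintegral_enorm]
  refine lintegral_congr_ae ?_
  filter_upwards [Lp.coeFn_sub (cellAvg μ U (fun A => ν A) n x) (cellAvg μ U (fun A => ν A) k x),
    Lp.coeFn_smul ((μ.real (cell U n (code U n x)))⁻¹) (ν (cell U n (code U n x))),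
    Lp.coeFn_smul ((μ.real (cell U k (code U k x)))⁻¹) (ν (cell U k (code U k x)))] with t h1 h2 h3
  rw [h1, Pi.sub_apply]
  simp only [cellAvg]
  rw [h2, h3, Pi.smul_apply, Pi.smul_apply]

theorem exists_density_of_tendsto_cellAvg [TopologicalSpace α] [BorelSpace α]
    [IsFiniteMeasure μ] {Y : Type*} [NormedAddCommGroup Y]
    [NormedSpace ℂ Y] [CompleteSpace Y] {F : VectorMeasure α Y}
    (hU : TopologicalSpace.IsTopologicalBasis (Set.range U)) (hUm : ∀ i, MeasurableSet (U i))
    (hF : ∀ A, MeasurableSet A → μ A = 0 → F A = 0)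
    (h : Tendsto (fun p : ℕ × ℕ => eLpNorm
      (cellAvg μ U (fun A => F A) p.1 - cellAvg μ U (fun A => F A) p.2) 1 μ) atTop (𝓝 0)) :
    ∃ f : α → Y, Integrable f μ ∧ F = μ.withDensityᵥ f := by
  have hi : ∀ n, Integrable (cellAvg μ U (fun A => F A) n) μ := fun n => integrable_cellAvg hUm _ n
  have hm : ∀ n, MemLp (cellAvg μ U (fun A => F A) n) 1 μ := fun n =>
    memLp_one_iff_integrable.2 (hi n)
  have hc : CauchySeq fun n => (hm n).toLp := by
    rw [EMetric.cauchySeq_iff]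
    intro ε hε
    obtain ⟨⟨N₁, N₂⟩, hN⟩ := eventually_atTop.1 (h.eventually (gt_mem_nhds hε))
    refine ⟨max N₁ N₂, fun n hn k hk => ?_⟩
    rw [Lp.edist_toLp_toLp]
    exact hN (n, k) ⟨(le_max_left _ _).trans hn, (le_max_right _ _).trans hk⟩
  obtain ⟨f, hf⟩ := cauchySeq_tendsto_of_complete hc
  have hfi : Integrable f μ := L1.integrable_coeFn f
  have hlim : Tendsto (fun n => eLpNorm (cellAvg μ U (fun A => F A) n - ⇑f) 1 μ) atTop (𝓝 0) := by
    refine ((Lp.tendsto_Lp_iff_tendsto_eLpNorm' _ _).1 hf).congr fun n => eLpNorm_congr_ae ?_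
    filter_upwards [(hm n).coeFn_toLp] with x hx
    rw [Pi.sub_apply, Pi.sub_apply, hx]
  have hadd : AdditiveOn U fun A => F A := fun A hA B hB hd =>
    VectorMeasure.of_union hd (measurableSet_of_mem_cellAlgebra hUm hA)
      (measurableSet_of_mem_cellAlgebra hUm hB)
  have hA : ∀ A ∈ cellAlgebra U, F A = μ.withDensityᵥ f A := by
    intro A hA
    rw [withDensityᵥ_apply hfi (measurableSet_of_mem_cellAlgebra hUm hA)]
    refine tendsto_nhds_unique ?_ (tendsto_setIntegral_of_L1' f hfi.aestronglyMeasurable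
      (Eventually.of_forall hi) hlim A)
    obtain ⟨k, hk⟩ := exists_level hA
    refine tendsto_const_nhds.congr' ?_
    filter_upwards [eventually_ge_atTop k] with n hn
    obtain ⟨S, rfl⟩ := hk n hn
    exact (setIntegral_cellAvg hUm hadd
      (fun c hc => hF _ (measurableSet_cell hUm n c) hc) S).symm
  exact ⟨f, hfi, VectorMeasure.ext_of_generateFrom (cellAlgebra U) hA
    (generateFrom_cellAlgebra hU) isPiSystem_cellAlgebra (hA _ univ_mem_cellAlgebra)⟩

variable [TopologicalSpace α] [CompactSpace α] [T2Space α] [BorelSpace α]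
  [IsProbabilityMeasure μ] [μ.WeaklyRegular] [SFinite σ] [IsFiniteMeasure ν.variation]

/-- The averages over the cells of a measure with values in `L¹` form a Cauchy sequence in mean, if
almost all of the scalar set functions `A ↦ ν A t` have densities. -/
theorem tendsto_eLpNorm_cellAvg_sub_cellAvg
    (hU : TopologicalSpace.IsTopologicalBasis (Set.range U)) (hUm : ∀ i, MeasurableSet (U i))
    (hw : ∀ᵐ t ∂σ, ∃ w : α → ℂ, Integrable w μ ∧ ∀ A ∈ cellAlgebra U, ν A t = ∫ x in A, w x ∂μ) :
    Tendsto (fun p : ℕ × ℕ => eLpNorm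
      (cellAvg μ U (fun A => ν A) p.1 - cellAvg μ U (fun A => ν A) p.2) 1 μ) atTop (𝓝 0) := by
  let D : ℕ × ℕ → β → ℝ≥0∞ := fun p t =>
    ∫⁻ x, ‖cellAvg μ U (fun A => ν A t) p.1 x - cellAvg μ U (fun A => ν A t) p.2 x‖ₑ ∂μ
  have hmeas : ∀ p : ℕ × ℕ, Measurable fun q : α × β =>
      ‖cellAvg μ U (fun A => ν A q.2) p.1 q.1 - cellAvg μ U (fun A => ν A q.2) p.2 q.1‖ₑ :=
    fun p => ((measurable_cellAvg_apply hUm p.1).sub (measurable_cellAvg_apply hUm p.2)).enorm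
  have hD : ∀ p : ℕ × ℕ, eLpNorm
      (cellAvg μ U (fun A => ν A) p.1 - cellAvg μ U (fun A => ν A) p.2) 1 μ = ∫⁻ t, D p t ∂σ := by
    intro p
    rw [eLpNorm_one_eq_lintegral_enorm]
    simp only [Pi.sub_apply, enorm_cellAvg_sub, D]
    exact lintegral_lintegral_swap (hmeas p).aemeasurable
  simp only [hD]
  rw [← lintegral_zero (μ := σ)]
  have hV : ∫⁻ t, cellVariation U ν t ∂σ < ∞ :=
    (lintegral_cellVariation_le hUm).trans_lt (measure_lt_top _ _)
  refine tendsto_lintegral_filter_of_dominated_convergence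
    (fun t => cellVariation U ν t + cellVariation U ν t)
    (Eventually.of_forall fun p => (hmeas p).lintegral_prod_left')
    (Eventually.of_forall fun p => Eventually.of_forall fun t => ?_) ?_ ?_
  · calc D p t ≤ ∫⁻ x, (‖cellAvg μ U (fun A => ν A t) p.1 x‖ₑ +
          ‖cellAvg μ U (fun A => ν A t) p.2 x‖ₑ) ∂μ := lintegral_mono fun x => enorm_sub_le
      _ = _ := lintegral_add_left' (integrable_cellAvg hUm _ _).aestronglyMeasurable.enorm _
      _ ≤ _ := add_le_add (lintegral_enorm_cellAvg_le_cellVariation hUm _ t)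
          (lintegral_enorm_cellAvg_le_cellVariation hUm _ t)
  · rw [lintegral_add_left measurable_cellVariation]
    exact (ENNReal.add_lt_top.2 ⟨hV, hV⟩).ne
  · filter_upwards [hw] with t ⟨w, hw, hwA⟩
    have e : ∀ n, cellAvg μ U (fun A => ν A t) n = cellAvg μ U (fun A => ∫ x in A, w x ∂μ) n :=
      fun n => by
        ext x
        simp only [cellAvg, hwA _ (cell_mem_cellAlgebra _ _)]
    have h1 := tendsto_eLpNorm_cellAvg_sub (μ := μ) hU hw
    have h2 := (h1.comp tendsto_fst).add (h1.comp tendsto_snd)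
    rw [prod_atTop_atTop_eq, add_zero] at h2
    refine tendsto_of_tendsto_of_tendsto_of_le_of_le tendsto_const_nhds h2 (fun _ => zero_le)
      fun p => ?_
    have h3 : D p t = eLpNorm (cellAvg μ U (fun A => ∫ x in A, w x ∂μ) p.1 -
        cellAvg μ U (fun A => ∫ x in A, w x ∂μ) p.2) 1 μ := by
      rw [eLpNorm_one_eq_lintegral_enorm]
      simp only [D, e]
      rfl
    have hi : ∀ n, Integrable (cellAvg μ U (fun A => ∫ x in A, w x ∂μ) n) μ := fun n =>
      integrable_cellAvg hUm _ n
    have h4 := eLpNorm_sub_le ((hi p.1).sub hw).aestronglyMeasurable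
      ((hi p.2).sub hw).aestronglyMeasurable le_rfl
    rw [sub_sub_sub_cancel_right] at h4
    rw [h3]
    exact h4

end RieszDensity

/-- Absolutely continuous measures with values in `L¹` whose spectrum is contained in a Riesz set
have Bochner integrable densities. -/
theorem IsRieszSet.exists_density {G : Type*} [CommGroup G] [TopologicalSpace G]
    [IsTopologicalGroup G] [CompactSpace G] [TopologicalSpace.MetrizableSpace G]
    [MeasurableSpace G] [BorelSpace G] {μ : Measure G} [IsProbabilityMeasure μ]
    {β : Type*} [MeasurableSpace β] {σ : Measure β} [SFinite σ]
    {Λ : Set (PontryaginDual G)} (hΛ : IsRieszSet μ Λ) {ν : VectorMeasure G (Lp ℂ 1 σ)}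
    (hν : ν ∈ spectralMeasuresAC (Lp ℂ 1 σ) μ Λ) :
    ∃ f : G → Lp ℂ 1 σ, Integrable f μ ∧ ν = μ.withDensityᵥ f := by
  have := countable_pontryaginDual G
  have : IsFiniteMeasure ν.variation := ⟨hν.1.1⟩
  obtain ⟨U, hU⟩ := exists_basis_seq_of_compact G
  have := hU.secondCountableTopology (Set.countable_range U)
  have hUm : ∀ i, MeasurableSet (U i) := fun i => (hU.isOpen ⟨i, rfl⟩).measurableSet
  refine exists_density_of_tendsto_cellAvg hU hUm hν.2
    (tendsto_eLpNorm_cellAvg_sub_cellAvg hU hUm ?_)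
  have hfourier : ∀ᵐ t ∂σ, ∀ γ ∉ Λ, Tendsto (fun n => ∫ x, (starRingEnd ℂ) (γ x : ℂ) *
      cellAvg μ U (fun A => ν A t) n x ∂μ) atTop (𝓝 0) := by
    refine ae_all_iff.2 fun γ => ?_
    by_cases hγ : γ ∈ Λ
    · exact Eventually.of_forall fun t h => absurd hγ h
    · have h1 : ν.integral (fun g => (starRingEnd ℂ) (γ g : ℂ)) (ContinuousLinearMap.lsmul ℝ ℂ) =
        0 := hν.1.2 γ hγ
      filter_upwards [ae_tendsto_integral_mul_cellAvg hU hUm hν.2 (continuous_conj_character γ),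
        Lp.coeFn_zero ℂ 1 σ] with t ht h0 _
      rwa [h1, h0] at ht
  let P : β → (G → ℂ) → Prop := fun t w => Integrable w μ ∧ ∀ φ : G → ℂ, Continuous φ → ∀ L,
      Tendsto (fun n => ∫ x, φ x * cellAvg μ U (fun A => ν A t) n x ∂μ) atTop (𝓝 L) →
        L = ∫ x, φ x * w x ∂μ
  have hex : ∀ᵐ t ∂σ, ∃ w, P t w := by
    filter_upwards [hfourier, ae_cellVariation_lt_top (ν := ν) hUm] with t ht hV
    refine hΛ.exists_integrable (fun n => integrable_cellAvg hUm _ n)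
      (C := (cellVariation U ν t).toNNReal) (fun n => ?_) ht
    rw [ENNReal.coe_toNNReal hV.ne]
    exact lintegral_enorm_cellAvg_le_cellVariation hUm n t
  obtain ⟨w, hw⟩ : ∃ w : β → G → ℂ, ∀ᵐ t ∂σ, P t (w t) :=
    ⟨fun t => Classical.epsilon (P t), hex.mono fun t h => Classical.epsilon_spec h⟩
  have hA : ∀ᵐ t ∂σ, ∀ A ∈ cellAlgebra U, ν A t = ∫ x in A, w t x ∂μ := by
    refine (ae_ball_iff countable_cellAlgebra).2 fun A hA =>
      ae_apply_eq_setIntegral hν.2 (fun φ hφ => ?_) (measurableSet_of_mem_cellAlgebra hUm hA)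
    filter_upwards [hw, ae_tendsto_integral_mul_cellAvg hU hUm hν.2 hφ] with t ht h1
    exact ⟨ht.1, ht.2 φ hφ _ h1⟩
  filter_upwards [hw, hA] with t h1 h2
  exact ⟨w t, h1.1, h2⟩

/-! ### Averaging operators on the injective tensor product -/

section AveragingOperators

theorem InjTensorProduct.sliceLeft_add {E F : Type*} [NormedAddCommGroup E] [NormedSpace ℂ E]
    [NormedAddCommGroup F] [NormedSpace ℂ F] [CompleteSpace F] (φ ψ : StrongDual ℂ E) :
    sliceLeft (F := F) (φ + ψ) = sliceLeft φ + sliceLeft ψ :=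
  clm_ext fun x y => by simp [sliceLeft_tmulRight, add_smul]

variable {β : Type*} [MeasurableSpace β] {σ : Measure β} {U : ℕ → Set β}

theorem integralOn_union {A B : Set β} (hB : MeasurableSet B) (hd : Disjoint A B) :
    integralOn σ (A ∪ B) = integralOn σ A + integralOn σ B := by
  ext w
  exact setIntegral_union hd hB (L1.integrable_coeFn w).integrableOn
    (L1.integrable_coeFn w).integrableOn

variable [IsFiniteMeasure σ]

/-- The operator on `L¹` that replaces a function by its averages over the cells of level `n`. -/
def cellProj (σ : Measure β) [IsFiniteMeasure σ] (hU : ∀ i, MeasurableSet (U i)) (n : ℕ) :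
    Lp ℂ 1 σ →L[ℂ] Lp ℂ 1 σ :=
  ∑ c, (integralOn σ (cell U n c)).smulRight (cellUnit σ hU n c)

theorem cellProj_apply (hU : ∀ i, MeasurableSet (U i)) (n : ℕ) (w : Lp ℂ 1 σ) :
    cellProj σ hU n w = ∑ c, integralOn σ (cell U n c) w • cellUnit σ hU n c := by
  simp [cellProj]

theorem norm_cellProj_apply_le (hU : ∀ i, MeasurableSet (U i)) (n : ℕ) (w : Lp ℂ 1 σ) :
    ‖cellProj σ hU n w‖ ≤ ‖w‖ := by
  rw [cellProj_apply, ← enorm_le_iff_norm_le, Lp.enorm_def, Lp.enorm_def]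
  exact (eLpNorm_congr_ae (coeFn_sum_smul_cellUnit hU (fun A => ∫ x in A, w x ∂σ) n)).trans_le
    (eLpNorm_cellAvg_setIntegral_le hU w n)

variable {X : Type*} [NormedAddCommGroup X] [NormedSpace ℂ X] [CompleteSpace X]

/-- The averaging operator, applied in the first factor of `L¹ ⊗̂_ε X`. -/
def cellProjTensor (σ : Measure β) [IsFiniteMeasure σ] (X : Type*) [NormedAddCommGroup X]
    [NormedSpace ℂ X] [CompleteSpace X] (hU : ∀ i, MeasurableSet (U i)) (n : ℕ) :
    InjTensorProduct (Lp ℂ 1 σ) X →L[ℂ] InjTensorProduct (Lp ℂ 1 σ) X :=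
  ∑ c, (InjTensorProduct.tmulRight (cellUnit σ hU n c)).comp
    (InjTensorProduct.sliceLeft (integralOn σ (cell U n c)))

theorem cellProjTensor_apply (hU : ∀ i, MeasurableSet (U i)) (n : ℕ)
    (z : InjTensorProduct (Lp ℂ 1 σ) X) :
    cellProjTensor σ X hU n z = ∑ c, InjTensorProduct.tmulRight (cellUnit σ hU n c)
      (InjTensorProduct.sliceLeft (integralOn σ (cell U n c)) z) := by
  simp [cellProjTensor]

theorem InjTensorProduct.tmulRight_sum {E F : Type*} [NormedAddCommGroup E] [NormedSpace ℂ E]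
    [NormedAddCommGroup F] [NormedSpace ℂ F] {ι : Type*} (s : Finset ι) (x : ι → E) (a : ι → ℂ)
    (y : F) : ∑ i ∈ s, tmulRight (x i) (a i • y) = tmulRight (∑ i ∈ s, a i • x i) y := by
  have h : ∑ i ∈ s, (x i ⊗ₜ[ℂ] (a i • y)) = (∑ i ∈ s, a i • x i) ⊗ₜ[ℂ] y := by
    simp [TensorProduct.sum_tmul, TensorProduct.smul_tmul']
  exact (map_sum (incl (E := E) (F := F)) (fun i => (x i ⊗ₜ[ℂ] (a i • y) : E ⊗[ℂ] F)) s).symm.trans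
    (congrArg incl h)

theorem cellProjTensor_tmulRight (hU : ∀ i, MeasurableSet (U i)) (n : ℕ) (w : Lp ℂ 1 σ) (x : X) :
    cellProjTensor σ X hU n (InjTensorProduct.tmulRight w x) =
      InjTensorProduct.tmulRight (cellProj σ hU n w) x := by
  rw [cellProjTensor_apply, cellProj_apply, ← InjTensorProduct.tmulRight_sum]
  simp only [InjTensorProduct.sliceLeft_tmulRight]

theorem norm_cellProjTensor_apply_le (hU : ∀ i, MeasurableSet (U i)) (n : ℕ)
    (z : InjTensorProduct (Lp ℂ 1 σ) X) : ‖cellProjTensor σ X hU n z‖ ≤ ‖z‖ := by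
  refine InjTensorProduct.norm_le_of_sliceLeft fun φ hφ => ?_
  have h : (InjTensorProduct.sliceLeft φ).comp (cellProjTensor σ X hU n) =
      InjTensorProduct.sliceLeft (φ.comp (cellProj σ hU n)) :=
    InjTensorProduct.clm_ext fun w x => by
      rw [ContinuousLinearMap.comp_apply, cellProjTensor_tmulRight,
        InjTensorProduct.sliceLeft_tmulRight, InjTensorProduct.sliceLeft_tmulRight,
        ContinuousLinearMap.comp_apply]
  have h1 := congrArg (fun T => T z) h
  simp only [ContinuousLinearMap.comp_apply] at h1
  rw [h1]
  refine (InjTensorProduct.norm_sliceLeft_le _ z).trans ?_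
  have h2 : ‖φ.comp (cellProj σ hU n)‖ ≤ 1 :=
    ContinuousLinearMap.opNorm_le_bound _ zero_le_one fun w =>
      (φ.le_of_opNorm_le hφ _).trans (by gcongr; exact norm_cellProj_apply_le hU n w)
  exact mul_le_of_le_one_left (norm_nonneg z) h2

theorem tendsto_cellProjTensor_apply [TopologicalSpace β] [CompactSpace β] [R1Space β]
    [BorelSpace β] {τ : Measure β} [τ.WeaklyRegular] [IsProbabilityMeasure τ]
    (hU : TopologicalSpace.IsTopologicalBasis (Set.range U)) (hUm : ∀ i, MeasurableSet (U i))
    (z : InjTensorProduct (Lp ℂ 1 τ) X) :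
    Tendsto (fun n => cellProjTensor τ X hUm n z) atTop (𝓝 z) := by
  have hdense : ∀ u : InjTensor (Lp ℂ 1 τ) X, Tendsto (fun n => cellProjTensor τ X hUm n
      (InjTensorProduct.incl u)) atTop (𝓝 (InjTensorProduct.incl u)) := by
    intro u
    induction u using TensorProduct.induction_on with
    | zero =>
      have h0 : InjTensorProduct.incl (0 : InjTensor (Lp ℂ 1 τ) X) = 0 := map_zero _
      have h1 : Tendsto (fun n => cellProjTensor τ X hUm n
        (InjTensorProduct.incl (0 : InjTensor (Lp ℂ 1 τ) X))) atTop
        (𝓝 (InjTensorProduct.incl (0 : InjTensor (Lp ℂ 1 τ) X))) := by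
        simp [h0]
      exact h1
    | tmul w x =>
      have h1 : Tendsto (fun n => InjTensorProduct.tmulRight (cellProj τ hUm n w) x) atTop
          (𝓝 (InjTensorProduct.tmulRight w x)) := by
        have h2 : Tendsto (fun n => cellProj τ hUm n w) atTop (𝓝 w) := by
          simp only [cellProj_apply]
          exact tendsto_sum_integralOn_smul_cellUnit hU hUm w
        rw [tendsto_iff_norm_sub_tendsto_zero] at h2 ⊢
        refine squeeze_zero (fun _ => norm_nonneg _) (fun n => ?_)
          (by simpa using h2.mul_const ‖x‖)
        refine le_trans (le_of_eq ?_) (InjTensorProduct.norm_tmulRight_le _ x)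
        have h3 : InjTensorProduct.incl (InjTensor.tmul (cellProj τ hUm n w - w) x) =
            InjTensorProduct.incl (InjTensor.tmul (cellProj τ hUm n w) x) -
              InjTensorProduct.incl (InjTensor.tmul w x) := by
          rw [← map_sub]
          exact congrArg _ (TensorProduct.sub_tmul _ _ _)
        exact congrArg norm h3.symm
      simp only [← cellProjTensor_tmulRight] at h1
      exact h1
    | add u v hu hv =>
      have h1 := hu.add hv
      have h2 : InjTensorProduct.incl (E := Lp ℂ 1 τ) (F := X) (u + v) =
          InjTensorProduct.incl u + InjTensorProduct.incl v := map_add _ u v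
      simp only [← map_add (cellProjTensor τ X hUm _), ← h2] at h1
      exact h1
  rw [Metric.tendsto_atTop]
  intro ε hε
  obtain ⟨u, hu⟩ := Metric.mem_closure_range_iff.1 (InjTensorProduct.denseRange_incl z) (ε / 3)
    (by positivity)
  obtain ⟨N, hN⟩ := Metric.tendsto_atTop.1 (hdense u) (ε / 3) (by positivity)
  refine ⟨N, fun n hn => ?_⟩
  have h1 : dist (cellProjTensor τ X hUm n z) (cellProjTensor τ X hUm n (InjTensorProduct.incl u))
      ≤ dist z (InjTensorProduct.incl u) := by
    rw [dist_eq_norm, dist_eq_norm, ← map_sub]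
    exact norm_cellProjTensor_apply_le hUm n _
  have h2 := dist_triangle4 (cellProjTensor τ X hUm n z)
    (cellProjTensor τ X hUm n (InjTensorProduct.incl u)) (InjTensorProduct.incl u) z
  rw [dist_comm (InjTensorProduct.incl u) z] at h2
  linarith [hN n hn]

end AveragingOperators

/-! ### Measures with values in the injective tensor product -/

section TensorDensity

/-- Separable sets are normed by countably many functionals. -/
theorem exists_countable_norming {X : Type*} [NormedAddCommGroup X] [NormedSpace ℂ X] {S : Set X}
    (hS : TopologicalSpace.IsSeparable S) :
    ∃ N : Set (StrongDual ℂ X), N.Countable ∧ (∀ ψ ∈ N, ‖ψ‖ ≤ 1) ∧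
      ∀ x ∈ S, ∀ r, (∀ ψ ∈ N, ‖ψ x‖ ≤ r) → ‖x‖ ≤ r := by
  obtain ⟨c, hc, hSc⟩ := hS
  choose ψ hψ1 hψ using fun x : X => exists_dual_vector'' ℂ x
  refine ⟨ψ '' c, hc.image ψ, ?_, fun x hx r hr => le_of_forall_pos_le_add fun ε hε => ?_⟩
  · rintro _ ⟨x, -, rfl⟩
    exact hψ1 x
  obtain ⟨y, hy, hxy⟩ := Metric.mem_closure_iff.1 (hSc hx) (ε / 2) (by positivity)
  rw [dist_eq_norm] at hxy
  have h1 : ‖ψ y y‖ = ‖y‖ := by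
    rw [hψ y]
    simp
  have h2 : ‖ψ y (x - y)‖ ≤ ‖x - y‖ :=
    ((ψ y).le_of_opNorm_le (hψ1 y) _).trans (one_mul _).le
  rw [map_sub] at h2
  have h3 := norm_le_norm_add_norm_sub (ψ y x) (ψ y y)
  have h4 := norm_le_norm_add_norm_sub y x
  rw [norm_sub_rev] at h4
  linarith [hr _ ⟨y, hy, rfl⟩, norm_sub_rev y x]

theorem exists_measure_lt_norm_setIntegral_le {β : Type*} [MeasurableSpace β] {σ : Measure β}
    {w : β → ℂ} (hw : Integrable w σ) {ε : ℝ} (hε : 0 < ε) :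
    ∃ δ : ℝ≥0∞, 0 < δ ∧ ∀ A, σ A < δ → ‖∫ x in A, w x ∂σ‖ ≤ ε := by
  obtain ⟨δ, hδ, h⟩ := exists_pos_setLIntegral_lt_of_measure_lt (μ := σ) (f := fun x => ‖w x‖ₑ)
    hw.2.ne (ENNReal.ofReal_pos.2 hε).ne'
  refine ⟨δ, hδ, fun A hA => ?_⟩
  rw [← ENNReal.ofReal_le_ofReal_iff hε.le, ofReal_norm]
  exact (enorm_integral_le_lintegral_enorm _).trans (h A hA).le

variable {α : Type*} [MeasurableSpace α] {μ : Measure α}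
  {Y Y' : Type*} [NormedAddCommGroup Y] [NormedSpace ℂ Y]
  [NormedAddCommGroup Y'] [NormedSpace ℂ Y'] [CompleteSpace Y']

theorem ae_enorm_le_of_mapCLM [SigmaFinite μ] {T : Y →L[ℂ] Y'} (hT : ∀ y, ‖T y‖ ≤ ‖y‖)
    {F : VectorMeasure α Y} {g : α → ℝ≥0∞} (hg : F.variation = μ.withDensity g) {f : α → Y'}
    (hf : Integrable f μ)
    (h : mapCLM T F = μ.withDensityᵥ f) : ∀ᵐ x ∂μ, ‖f x‖ₑ ≤ g x := by
  refine ae_le_of_withDensity_le hf.aestronglyMeasurable.enorm ?_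
  rw [← Measure.variation_withDensityᵥ hf, ← h, ← hg]
  refine VectorMeasure.variation_le_of_forall_enorm_le fun A _ => ?_
  rw [mapCLM_apply]
  exact (enorm_le_iff_norm_le.2 (hT _)).trans (VectorMeasure.enorm_measure_le_variation _ _)

/-- A vector measure has a density if it is the setwise limit of measures whose densities are
dominated by an integrable function and converge almost everywhere. -/
theorem exists_density_of_tendsto [CompleteSpace Y] {F : VectorMeasure α Y} {f : ℕ → α → Y}
    (hf : ∀ n, Integrable (f n) μ) {g : α → ℝ≥0∞} (hg : AEMeasurable g μ)
    (hgi : ∫⁻ x, g x ∂μ ≠ ∞) (hfg : ∀ n, ∀ᵐ x ∂μ, ‖f n x‖ₑ ≤ g x)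
    (hlim : ∀ᵐ x ∂μ, CauchySeq fun n => f n x)
    (hF : ∀ A, MeasurableSet A → Tendsto (fun n => ∫ x in A, f n x ∂μ) atTop (𝓝 (F A))) :
    ∃ w : α → Y, Integrable w μ ∧ F = μ.withDensityᵥ w := by
  obtain ⟨w, hwm, hw⟩ := exists_stronglyMeasurable_limit_of_tendsto_ae
    (fun n => (hf n).aestronglyMeasurable)
    (hlim.mono fun x hx => cauchySeq_tendsto_of_complete hx)
  have hgt : ∀ᵐ x ∂μ, g x < ∞ := ae_lt_top' hg hgi
  have hwg : ∀ᵐ x ∂μ, ‖w x‖ₑ ≤ g x := by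
    filter_upwards [hw, ae_all_iff.2 hfg] with x hx h
    exact le_of_tendsto ((continuous_enorm.tendsto _).comp hx) (Eventually.of_forall h)
  have hwi : Integrable w μ :=
    ⟨hwm.aestronglyMeasurable, (lintegral_mono_ae hwg).trans_lt hgi.lt_top⟩
  refine ⟨w, hwi, VectorMeasure.ext fun A hA => ?_⟩
  rw [withDensityᵥ_apply hwi hA]
  refine tendsto_nhds_unique (hF A hA) (tendsto_integral_of_dominated_convergence
    (fun x => (g x).toReal) (fun n => (hf n).aestronglyMeasurable.restrict)
    (integrable_toReal_of_lintegral_ne_top hg hgi).integrableOn (fun n => ?_)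
    (ae_restrict_of_ae hw))
  refine ae_restrict_of_ae ?_
  filter_upwards [hfg n, hgt] with x hx hgx
  rw [← toReal_enorm]
  exact ENNReal.toReal_mono hgx.ne hx

variable [IsFiniteMeasure μ] {β : Type*} [TopologicalSpace β] [CompactSpace β] [R1Space β]
  [MeasurableSpace β] [BorelSpace β] {σ : Measure β} [σ.WeaklyRegular] [IsProbabilityMeasure σ]
  {X : Type*} [NormedAddCommGroup X] [NormedSpace ℂ X] [CompleteSpace X]

/-- Let `X` have the Schur property. A measure `F` with values in `L¹ ⊗̂_ε X` has a density as soon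
as its slices `(φ ⊗ id) F` and `(id ⊗ ψ) F` do. For almost every point `s`, the densities of the
slices over the cells form a set function with values in `X`, which is absolutely continuous by
`AdditiveOn.exists_delta`; hence the averages over the cells converge at `s` by
`cauchySeq_sum_smul_cellUnit` and `InjTensorProduct.cauchySeq_of_sliceRight`. -/
theorem exists_density_injTensorProduct (hX : HasSchurProperty X) {U : ℕ → Set β}
    (hU : TopologicalSpace.IsTopologicalBasis (Set.range U))
    {F : VectorMeasure α (InjTensorProduct (Lp ℂ 1 σ) X)} [IsFiniteMeasure F.variation]
    (hF : F.variation ≪ μ)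
    (hleft : ∀ A ∈ cellAlgebra U, ∃ f : α → X, Integrable f μ ∧
      mapCLM (InjTensorProduct.sliceLeft (integralOn σ A)) F = μ.withDensityᵥ f)
    (hright : ∀ ψ : StrongDual ℂ X, ∃ f : α → Lp ℂ 1 σ, Integrable f μ ∧
      mapCLM (InjTensorProduct.sliceRight ψ) F = μ.withDensityᵥ f) :
    ∃ f : α → InjTensorProduct (Lp ℂ 1 σ) X, Integrable f μ ∧ F = μ.withDensityᵥ f := by
  have hUm : ∀ i, MeasurableSet (U i) := fun i => (hU.isOpen ⟨i, rfl⟩).measurableSet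
  choose! f hf hfF using hleft
  choose h hh hhF using hright
  let g : α → ℝ≥0∞ := F.variation.rnDeriv μ
  have hg : F.variation = μ.withDensity g := (Measure.withDensity_rnDeriv_eq _ _ hF).symm
  have hgm : Measurable g := Measure.measurable_rnDeriv _ _
  have hgi : ∫⁻ x, g x ∂μ ≠ ∞ := (Measure.lintegral_rnDeriv_lt_top _ _).ne
  have hadd : ∀ᵐ s ∂μ, AdditiveOn U fun A => f A s := by
    have h1 : ∀ᵐ s ∂μ, ∀ A ∈ cellAlgebra U, ∀ B ∈ cellAlgebra U, Disjoint A B →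
        f (A ∪ B) s = f A s + f B s := by
      refine (ae_ball_iff countable_cellAlgebra).2 fun A hA =>
        (ae_ball_iff countable_cellAlgebra).2 fun B hB => ?_
      by_cases hd : Disjoint A B
      · have h2 : μ.withDensityᵥ (f (A ∪ B)) = μ.withDensityᵥ (f A + f B) := by
          rw [withDensityᵥ_add (hf A hA) (hf B hB), ← hfF _ (union_mem_cellAlgebra hA hB),
            ← hfF A hA, ← hfF B hB]
          refine VectorMeasure.ext fun S _ => ?_
          rw [add_apply, mapCLM_apply, mapCLM_apply, mapCLM_apply,
            integralOn_union (measurableSet_of_mem_cellAlgebra hUm hB) hd,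
            InjTensorProduct.sliceLeft_add]
          rfl
        filter_upwards [(hf _ (union_mem_cellAlgebra hA hB)).ae_eq_of_withDensityᵥ_eq
          ((hf A hA).add (hf B hB)) h2] with s hs _
        rw [hs, Pi.add_apply]
      · exact Eventually.of_forall fun s h => absurd h hd
    exact h1
  have hbound : ∀ᵐ s ∂μ, ∀ A ∈ cellAlgebra U, ‖f A s‖ₑ ≤ g s := by
    refine (ae_ball_iff countable_cellAlgebra).2 fun A hA =>
      ae_enorm_le_of_mapCLM (fun z => ?_) hg (hf A hA) (hfF A hA)
    exact (InjTensorProduct.norm_sliceLeft_le _ z).trans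
      (mul_le_of_le_one_left (norm_nonneg z) (norm_integralOn_le A))
  have hψ : ∀ ψ : StrongDual ℂ X, ∀ᵐ s ∂μ, ∀ A ∈ cellAlgebra U,
      ψ (f A s) = ∫ x in A, h ψ s x ∂σ := by
    intro ψ
    refine (ae_ball_iff countable_cellAlgebra).2 fun A hA => ?_
    have h1 : μ.withDensityᵥ (fun s => ψ (f A s)) =
        μ.withDensityᵥ fun s => integralOn σ A (h ψ s) :=
      calc _ = mapCLM ψ (μ.withDensityᵥ (f A)) := (mapCLM_withDensityᵥ ψ (hf A hA)).symm
        _ = mapCLM ψ (mapCLM (InjTensorProduct.sliceLeft (integralOn σ A)) F) := by rw [hfF A hA]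
        _ = mapCLM (integralOn σ A) (mapCLM (InjTensorProduct.sliceRight ψ) F) :=
          VectorMeasure.ext fun S _ => InjTensorProduct.apply_sliceLeft_eq _ _ _
        _ = mapCLM (integralOn σ A) (μ.withDensityᵥ (h ψ)) := congrArg _ (hhF ψ)
        _ = _ := mapCLM_withDensityᵥ _ (hh ψ)
    exact (ψ.integrable_comp (hf A hA)).ae_eq_of_withDensityᵥ_eq
      ((integralOn σ A).integrable_comp (hh ψ)) h1
  -- almost all values of the densities lie in a separable set
  obtain ⟨S, hS, hfS⟩ : ∃ S : Set X, TopologicalSpace.IsSeparable S ∧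
      ∀ᵐ s ∂μ, ∀ A ∈ cellAlgebra U, f A s ∈ S := by
    have h1 : ∀ A ∈ cellAlgebra U, ∃ t : Set X, TopologicalSpace.IsSeparable t ∧
        ∀ᵐ s ∂μ, f A s ∈ t := fun A hA =>
      (hf A hA).aestronglyMeasurable.isSeparable_ae_range
    choose! t ht hft using h1
    refine ⟨⋃ A ∈ cellAlgebra U, t A, ?_, (ae_ball_iff countable_cellAlgebra).2 fun A hA => ?_⟩
    · have : Countable (cellAlgebra U) := countable_cellAlgebra.to_subtype
      rw [Set.biUnion_eq_iUnion]
      exact TopologicalSpace.IsSeparable.iUnion fun A => ht A A.2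
    · filter_upwards [hft A hA] with s hs
      exact Set.mem_biUnion hA hs
  obtain ⟨N, hNc, hN1, hN⟩ := exists_countable_norming hS
  let z : ℕ → α → InjTensorProduct (Lp ℂ 1 σ) X := fun n s =>
    ∑ c, InjTensorProduct.tmulRight (cellUnit σ hUm n c) (f (cell U n c) s)
  have hzi : ∀ n, Integrable (z n) μ := fun n => integrable_finsetSum _ fun c _ =>
    (InjTensorProduct.tmulRight (cellUnit σ hUm n c)).integrable_comp
      (hf _ (cell_mem_cellAlgebra n c))
  have hzF : ∀ n, ∀ A, MeasurableSet A →
      ∫ s in A, z n s ∂μ = cellProjTensor σ X hUm n (F A) := by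
    intro n A hA
    rw [cellProjTensor_apply]
    refine (integral_finsetSum _ fun c _ =>
      ((InjTensorProduct.tmulRight (cellUnit σ hUm n c)).integrable_comp
        (hf _ (cell_mem_cellAlgebra n c))).integrableOn).trans
      (Finset.sum_congr rfl fun c _ => ?_)
    have hc := cell_mem_cellAlgebra (U := U) n c
    rw [ContinuousLinearMap.integral_comp_comm _ (hf _ hc).integrableOn,
      ← withDensityᵥ_apply (hf _ hc) hA, ← hfF _ hc, mapCLM_apply]
  refine exists_density_of_tendsto hzi hgm.aemeasurable hgi (fun n => ?_) ?_ fun A hA => ?_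
  · refine ae_enorm_le_of_mapCLM (norm_cellProjTensor_apply_le hUm n) hg (hzi n)
      (VectorMeasure.ext fun A hA => ?_)
    rw [withDensityᵥ_apply (hzi n) hA, hzF n A hA, mapCLM_apply]
  · filter_upwards [hadd, hbound, (ae_ball_iff hNc).2 fun ψ _ => hψ ψ, hfS,
      Measure.rnDeriv_lt_top F.variation μ] with s hs hsg hsψ hsS hgs
    have hC : ∀ A ∈ cellAlgebra U, ‖f A s‖ ≤ (g s).toReal := fun A hA => by
      rw [← toReal_enorm]
      exact ENNReal.toReal_mono hgs.ne (hsg A hA)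
    have hδ : ∀ ε : ℝ, 0 < ε → ∃ δ : ℝ≥0∞, 0 < δ ∧
        ∀ A ∈ cellAlgebra U, σ A < δ → ‖f A s‖ ≤ ε := fun ε hε =>
      hs.exists_delta hX hC hN1 (fun A hA r hr => hN _ (hsS A hA) r hr) (fun ψ hψN ε hε => by
        obtain ⟨δ, hδ, hδA⟩ := exists_measure_lt_norm_setIntegral_le
          (L1.integrable_coeFn (h ψ s)) hε
        refine ⟨δ, hδ, fun A hA hAδ => ?_⟩
        rw [hsψ ψ hψN A hA]
        exact hδA A hAδ) hε
    refine InjTensorProduct.cauchySeq_of_sliceRight hX _ fun ψ => ?_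
    have h1 : AdditiveOn U fun A => ψ (f A s) := hs.map ψ.toLinearMap.toAddMonoidHom
    have h2 := cauchySeq_sum_smul_cellUnit (μ := σ) hUm h1 (C := ‖ψ‖ * (g s).toReal)
      (fun A hA => (ψ.le_opNorm _).trans (by gcongr; exact hC A hA)) fun ε hε => by
        obtain ⟨δ, hδ0, hδA⟩ := hδ (ε / (‖ψ‖ + 1)) (by positivity)
        refine ⟨δ, hδ0, fun A hA hAδ => (ψ.le_opNorm _).trans ?_⟩
        calc ‖ψ‖ * ‖f A s‖ ≤ (‖ψ‖ + 1) * (ε / (‖ψ‖ + 1)) := by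
              gcongr
              · linarith
              · exact hδA A hA hAδ
          _ = ε := mul_div_cancel₀ _ (by positivity)
    simpa only [z, map_sum, InjTensorProduct.sliceRight_tmulRight] using h2
  · simp only [hzF _ A hA]
    exact tendsto_cellProjTensor_apply hU hUm (F A)

end TensorDensity

/-! ### The Radon–Nikodym properties of the injective tensor product -/

section Transfer

variable {G : Type*} [MeasurableSpace G] {μ : Measure G} [IsProbabilityMeasure μ]
  {X : Type*} [NormedAddCommGroup X] [NormedSpace ℂ X] [CompleteSpace X]

/-- A measure with values in `X` has a density if its image under `x ↦ 1 ⊗ x` does. -/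
theorem exists_density_of_tmulRight_one {F : VectorMeasure G X}
    (h : ∃ f : G → InjTensorProduct (Lp ℂ 1 μ) X, Integrable f μ ∧
      mapCLM (InjTensorProduct.tmulRight (Lp.const 1 μ (1 : ℂ))) F = μ.withDensityᵥ f) :
    ∃ f : G → X, Integrable f μ ∧ F = μ.withDensityᵥ f := by
  refine exists_density_of_complemented
    (P := InjTensorProduct.sliceLeft (integralOn μ Set.univ)) (fun x => ?_) h
  have h1 : integralOn μ Set.univ (Lp.const 1 μ (1 : ℂ)) = 1 := by
    rw [integralOn_apply, setIntegral_univ, integral_congr_ae (Lp.coeFn_const 1 μ (1 : ℂ))]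
    simp
  rw [InjTensorProduct.sliceLeft_tmulRight, h1, one_smul]

/-- Over a Riesz set, the only obstruction to a density of a measure with values in `L¹ ⊗̂_ε X`
comes from its slices in `X`. -/
theorem IsRieszSet.exists_density_injTensorProduct [CommGroup G] [TopologicalSpace G]
    [IsTopologicalGroup G] [CompactSpace G] [TopologicalSpace.MetrizableSpace G] [BorelSpace G]
    {Λ : Set (PontryaginDual G)} (hX : HasSchurProperty X)
    (hΛ : IsRieszSet μ Λ) {F : VectorMeasure G (InjTensorProduct (Lp ℂ 1 μ) X)}
    (hF : F ∈ spectralMeasuresAC (InjTensorProduct (Lp ℂ 1 μ) X) μ Λ)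
    (hleft : ∀ φ : StrongDual ℂ (Lp ℂ 1 μ), ∃ f : G → X, Integrable f μ ∧
      mapCLM (InjTensorProduct.sliceLeft φ) F = μ.withDensityᵥ f) :
    ∃ f : G → InjTensorProduct (Lp ℂ 1 μ) X, Integrable f μ ∧ F = μ.withDensityᵥ f := by
  have : IsFiniteMeasure F.variation := ⟨hF.1.1⟩
  obtain ⟨U, hU⟩ := exists_basis_seq_of_compact G
  have := hU.secondCountableTopology (Set.countable_range U)
  exact _root_.exists_density_injTensorProduct hX hU (variation_absolutelyContinuous hF.2)
    (fun A _ => hleft _) fun ψ => hΛ.exists_density (mapCLM_mem_spectralMeasuresAC _ hF)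

end Transfer

end

theorem corollary1 {G : Type*} [CommGroup G] [TopologicalSpace G] [IsTopologicalGroup G]
    [CompactSpace G] [TopologicalSpace.MetrizableSpace G] [MeasurableSpace G] [BorelSpace G]
    (haar : Measure G) [haar.IsHaarMeasure] [IsProbabilityMeasure haar]
    {X : Type*} [NormedAddCommGroup X] [NormedSpace ℂ X] [CompleteSpace X]
    (hX : HasSchurProperty X)
    (Λ : Set (PontryaginDual G)) (hΛ : IsRieszSet haar Λ) :
    (HasTypeIRNP (InjTensorProduct (Lp ℂ 1 haar) X) haar Λ ↔ HasTypeIRNP X haar Λ) ∧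
    (HasTypeIIRNP (InjTensorProduct (Lp ℂ 1 haar) X) haar Λ ↔ HasTypeIIRNP X haar Λ) := by
  simp only [hasTypeIRNP_iff, hasTypeIIRNP_iff]
  refine ⟨⟨fun h F hF => ?_, fun h F hF => ?_⟩, ⟨fun h F hF => ?_, fun h F hF => ?_⟩⟩
  · exact exists_density_of_tmulRight_one (h _ (mapCLM_mem_spectralMeasuresBdd _ hF))
  · exact hΛ.exists_density_injTensorProduct hX (spectralMeasuresBdd_subset_AC hF)
      fun φ => h _ (mapCLM_mem_spectralMeasuresBdd _ hF)
  · exact exists_density_of_tmulRight_one (h _ (mapCLM_mem_spectralMeasuresAC _ hF))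
  · exact hΛ.exists_density_injTensorProduct hX hF
      fun φ => h _ (mapCLM_mem_spectralMeasuresAC _ hF)
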